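/- Let $A,B\in\mathbb C^{n\times n}$ be Hermitian and suppose that the matrix pencil $A-\lambda B$ is positive semi-definite, i.e. $A-\lambda_0B\succeq 0$ for some $\lambda_0\in\mathbb R$. Let $B$ (possibly singular) have $n_+$ positive and $n_-$ negative eigenvalues, counted with multiplicity, and suppose that $B$ is genuinely indefinite, i.e. $n_+\ge 1$ and $n_-\ge 1$. A number $\mu\in\mathbb C$ is a finite eigenvalue of $A-\lambda B$ if $\operatorname{rank}(A-\mu B)<\rho:=\max_{\lambda\in\mathbb C}\operatorname{rank}(A-\lambda B)$, and $x\in\mathbb C^n$ is an associated eigenvector if $x\neq0$, $Ax=\mu Bx$, and $x$ does not lie in the common null space of $A$ and $B$. The algebraic multiplicity of $\mu$ is its multiplicity as a root of the greatest common divisor of all $\rho\times\rho$ minors of $A-\lambda B$ (which is $\det(A-\lambda B)$, up to a constant factor, if this is not identically zero). Counted with multiplicity, the pencil has exactly $n_++n_-=\operatorname{rank}B$ finite eigenvalues, and they are all real. Denote them by $$\lambda^-_{n_-}\le\cdots\le\lambda^-_1\le\lambda^+_1\le\cdots\le\lambda^+_{n_+}.$$ Let $k\le n_+$, let $D\in\mathbb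 C^{k\times k}$ be Hermitian, and let $Q\in\mathbb C^{k\times k}$ be a unitary matrix with $Q^{H}DQ=\operatorname{diag}(\omega_1,\dots,\omega_k)$, where $\omega_1\ge\cdots\ge\omega_k$ are real. (1) If $A$ is not a real scalar multiple of $B$ (so that in particular $A\ne0$), then $$\inf_{X\in\mathbb C^{n\times k},\;X^{H}BX=I_k}\operatorname{tr}(DX^{H}AX)>-\infty\quad\text{if and only if}\quad D\succeq0 .$$ (2) If $D\succeq0$, then, whether or not $A$ is a scalar multiple of $B$, $$\inf_{X^{H}BX=I_k}\operatorname{tr}(DX^{H}AX)=\sum_{i=1}^k\omega_i\lambda_i^+ .$$ (3) If $D\succeq0$ and $A-\lambda B$ is diagonalizable, i.e. there is a nonsingular $U\in\mathbb C^{n\times n}$ such that $U^{H}AU$ and $U^{H}BU$ are both diagonal, then there is an $X$ with $X^{H}BX=I_k$ such that the columns of $XQ$ are eigenvectors of $A-\lambda B$ associated with $\lambda_1^+,\dots,\lambda_k^+$, respectively, and every such $X$ attains the infimum. -/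

import Mathlib

open scoped ComplexOrder Matrix

noncomputable section

/-- The matrix pencil `A - λ B` is positive semi-definite: `A` and `B` are Hermitian and
`A - λ₀ B ⪰ 0` for some real `λ₀`. -/
def IsPosSemidefPencil {n : ℕ} (A B : Matrix (Fin n) (Fin n) ℂ) : Prop :=
  A.IsHermitian ∧ B.IsHermitian ∧ ∃ l₀ : ℝ, (A - (l₀ : ℂ) • B).PosSemidef

/-- The number `n₊` of positive eigenvalues (with multiplicity) of a Hermitian matrix. -/
def posInertia {n : ℕ} {B : Matrix (Fin n) (Fin n) ℂ} (hB : B.IsHermitian) : ℕ :=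
  (Finset.univ.filter fun i => 0 < hB.eigenvalues i).card

/-- The number `n₋` of negative eigenvalues (with multiplicity) of a Hermitian matrix. -/
def negInertia {n : ℕ} {B : Matrix (Fin n) (Fin n) ℂ} (hB : B.IsHermitian) : ℕ :=
  (Finset.univ.filter fun i => hB.eigenvalues i < 0).card

/-- The maximum of `rank (A - λ B)` over all `λ ∈ ℂ` (the ranks are bounded by `n`). -/
def normalRank {n : ℕ} (A B : Matrix (Fin n) (Fin n) ℂ) : ℕ :=
  ⨆ l : ℂ, (A - l • B).rank

/-- `μ ∈ ℂ` is a finite eigenvalue of `A - λ B`: the rank drops at `μ`. -/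
def IsFiniteEigenvalue {n : ℕ} (A B : Matrix (Fin n) (Fin n) ℂ) (μ : ℂ) : Prop :=
  (A - μ • B).rank < normalRank A B

/-- `x` is an eigenvector of `A - λ B` for the finite eigenvalue `μ`: `A x = μ B x`, and `x` is
not in the common null space of `A` and `B` (in particular `x ≠ 0`). -/
def IsPencilEigenvector {n : ℕ} (A B : Matrix (Fin n) (Fin n) ℂ) (μ : ℂ) (x : Fin n → ℂ) : Prop :=
  IsFiniteEigenvalue A B μ ∧ x ≠ 0 ∧ ¬ (A *ᵥ x = 0 ∧ B *ᵥ x = 0) ∧ A *ᵥ x = μ • (B *ᵥ x)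

/-- The pencil `A - λ B` as a matrix over the polynomial ring `ℂ[λ]`. -/
def pencilMatrix {n : ℕ} (A B : Matrix (Fin n) (Fin n) ℂ) :
    Matrix (Fin n) (Fin n) (Polynomial ℂ) :=
  A.map Polynomial.C - (Polynomial.X : Polynomial ℂ) • B.map Polynomial.C

/-- The ideal of `ℂ[λ]` generated by the minors of `A - λ B` whose order is the normal rank.
(Row and column selections with repetitions only contribute the minor `0`.) -/
def determinantalIdeal {n : ℕ} (A B : Matrix (Fin n) (Fin n) ℂ) : Ideal (Polynomial ℂ) :=
  Ideal.span (Set.range fun p : (Fin (normalRank A B) → Fin n) × (Fin (normalRank A B) → Fin n) =>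
    ((pencilMatrix A B).submatrix p.1 p.2).det)

/-- The finite eigenvalues of `A - λ B` with their algebraic multiplicities: the roots of the
greatest common divisor of the minors of maximal nonvanishing order, which is the product of
the invariant polynomials of the pencil. If `det (A - λ B)` is not identically zero, this
multiset consists of the roots of `det (A - λ B)`. -/
def finiteEigenvalues {n : ℕ} (A B : Matrix (Fin n) (Fin n) ℂ) : Multiset ℂ :=
  (Submodule.IsPrincipal.generator (determinantalIdeal A B)).roots

/-- The positive-type eigenvalue `λ⁺` with (zero-based) index `i`: the finite eigenvalues, which
are real, are listed in ascending order with multiplicities; the first `n₋` of them are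
`λ⁻_{n₋} ≤ ⋯ ≤ λ⁻_1`, and the next ones are `λ⁺_1 ≤ ⋯ ≤ λ⁺_{n₊}`. -/
def posTypeEigenvalue {n : ℕ} (A : Matrix (Fin n) (Fin n) ℂ) {B : Matrix (Fin n) (Fin n) ℂ}
    (hB : B.IsHermitian) (i : ℕ) : ℝ :=
  (((finiteEigenvalues A B).map Complex.re).sort (· ≤ ·)).getD (negInertia hB + i) 0

/-- The Hermitian pencil `A - λ B` is diagonalizable: one congruence transformation makes both
`A` and `B` diagonal. -/
def IsDiagonalizablePencil {n : ℕ} (A B : Matrix (Fin n) (Fin n) ℂ) : Prop :=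
  ∃ U : Matrix (Fin n) (Fin n) ℂ, IsUnit U.det ∧ (Uᴴ * A * U).IsDiag ∧ (Uᴴ * B * U).IsDiag

/-- The infimum, in the extended reals, of `tr (D Xᴴ A X)` subject to `Xᴴ B X = I_k`. The trace
is a real number when `A` and `D` are Hermitian. -/
def traceInf {n k : ℕ} (A B : Matrix (Fin n) (Fin n) ℂ) (D : Matrix (Fin k) (Fin k) ℂ) : EReal :=
  ⨅ X : {X : Matrix (Fin n) (Fin k) ℂ // Xᴴ * B * X = 1},
    (((D * (X.1ᴴ * A * X.1)).trace.re : ℝ) : EReal)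

/-- `X` is feasible, and the columns of `X Q` are eigenvectors of `A - λ B` associated with
`λ⁺_1, …, λ⁺_k`, respectively. -/
def IsEigenvectorSolution {n k : ℕ} (A : Matrix (Fin n) (Fin n) ℂ)
    {B : Matrix (Fin n) (Fin n) ℂ} (hB : B.IsHermitian) (Q : Matrix (Fin k) (Fin k) ℂ)
    (X : Matrix (Fin n) (Fin k) ℂ) : Prop :=
  Xᴴ * B * X = 1 ∧
    ∀ i : Fin k, IsPencilEigenvector A B ((posTypeEigenvalue A hB i : ℝ) : ℂ) ((X * Q).col i)

theorem exists_minor_ne_zero {n r : ℕ} (M : Matrix (Fin n) (Fin n) ℂ) (h : r ≤ M.rank) :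
    ∃ f g : Fin r → Fin n, (M.submatrix f g).det ≠ 0 := by
  have key : ∀ {p q s : ℕ} (N : Matrix (Fin p) (Fin q) ℂ), s ≤ N.rank →
      ∃ f : Fin s → Fin p, LinearIndependent ℂ (N.submatrix f id).row := by
    intro p q s N hs
    obtain ⟨v, hv, -, hli⟩ := Submodule.exists_fun_fin_finrank_span_eq ℂ (Set.range N.row)
    choose c hc using hv
    have hs' : s ≤ Module.finrank ℂ (Submodule.span ℂ (Set.range N.row)) := by
      rwa [← Matrix.rank_eq_finrank_span_row]
    refine ⟨fun i => c (Fin.castLE hs' i), ?_⟩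
    have h2 := hli.comp (Fin.castLE hs') (Fin.castLE_injective hs')
    have h3 : (N.submatrix (fun i => c (Fin.castLE hs' i)) id).row = v ∘ Fin.castLE hs' := by
      funext i
      exact hc _
    rw [h3]
    exact h2
  obtain ⟨f, hf⟩ := key M h
  have hr : r ≤ ((M.submatrix f id)ᵀ).rank := by
    rw [Matrix.rank_transpose, hf.rank_matrix, Fintype.card_fin]
  obtain ⟨g, hg⟩ := key (M.submatrix f id)ᵀ hr
  refine ⟨f, g, ?_⟩
  have h3 := Matrix.linearIndependent_rows_iff_isUnit.mp hg
  rw [Matrix.isUnit_iff_isUnit_det] at h3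
  rw [← Matrix.det_transpose]
  exact h3.ne_zero

theorem le_rank_of_minor_ne_zero {n r : ℕ} (M : Matrix (Fin n) (Fin n) ℂ) (f g : Fin r → Fin n)
    (h : (M.submatrix f g).det ≠ 0) : r ≤ M.rank := by
  have h1 := Matrix.rank_of_det_ne_zero h
  rw [Fintype.card_fin] at h1
  exact h1 ▸ Matrix.rank_submatrix_le M f g

theorem eval_minor {n r : ℕ} (A B : Matrix (Fin n) (Fin n) ℂ) (μ : ℂ) (f g : Fin r → Fin n) :
    (((pencilMatrix A B).submatrix f g).det).eval μ = ((A - μ • B).submatrix f g).det := by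
  rw [← Polynomial.coe_evalRingHom, RingHom.map_det]
  congr 1
  ext i j
  simp [pencilMatrix]
  exact mul_comm _ _

theorem rank_le_normalRank {n : ℕ} (A B : Matrix (Fin n) (Fin n) ℂ) (μ : ℂ) :
    (A - μ • B).rank ≤ normalRank A B :=
  le_ciSup (f := fun l : ℂ => (A - l • B).rank)
    ⟨n, by rintro _ ⟨l, rfl⟩; exact Matrix.rank_le_width _⟩ μ

/-- The members of the multiset `finiteEigenvalues` are exactly the numbers at which the rank
of the pencil drops. -/
theorem mem_finiteEigenvalues_iff {n : ℕ} (A B : Matrix (Fin n) (Fin n) ℂ) (μ : ℂ) :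
    μ ∈ finiteEigenvalues A B ↔ IsFiniteEigenvalue A B μ := by
  have hroot : ∀ l : ℂ, (Submodule.IsPrincipal.generator (determinantalIdeal A B)).eval l = 0 ↔
      IsFiniteEigenvalue A B l := by
    intro l
    constructor
    · intro h0
      by_contra hlt
      obtain ⟨f, g, hfg⟩ := exists_minor_ne_zero (A - l • B) (not_lt.mp hlt)
      apply hfg
      rw [← eval_minor]
      have hmem : ((pencilMatrix A B).submatrix f g).det ∈ determinantalIdeal A B :=
        Ideal.subset_span ⟨(f, g), rfl⟩
      obtain ⟨q, hq⟩ := (Submodule.IsPrincipal.mem_iff_generator_dvd _).mp hmem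
      rw [hq, Polynomial.eval_mul, h0, zero_mul]
    · intro hlt
      have hle : determinantalIdeal A B ≤ RingHom.ker (Polynomial.evalRingHom l) := by
        refine Ideal.span_le.mpr ?_
        rintro _ ⟨⟨f, g⟩, rfl⟩
        by_contra hne
        refine absurd (le_rank_of_minor_ne_zero (A - l • B) f g ?_) (not_le.mpr hlt)
        rw [← eval_minor]
        exact hne
      exact hle (Submodule.IsPrincipal.generator_mem _)
  have hne : Submodule.IsPrincipal.generator (determinantalIdeal A B) ≠ 0 := by
    intro h0
    obtain ⟨l, hl⟩ := Nat.sSup_mem (Set.range_nonempty fun l : ℂ => (A - l • B).rank)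
      ⟨n, by rintro _ ⟨l, rfl⟩; exact Matrix.rank_le_width _⟩
    have h1 : IsFiniteEigenvalue A B l := (hroot l).mp (by rw [h0, Polynomial.eval_zero])
    exact absurd hl (ne_of_lt h1)
  rw [finiteEigenvalues, Polynomial.mem_roots hne]
  exact hroot μ

end

/-!
Let `C = A - l₀ B ⪰ 0`, and let `J = diag (I_p, -I_q)` be the signature of `B`. A congruence and a
Schur complement bring the pencil `A - λ B` into the form `(S - λ J) ⊕ 1 ⊕ 0` with `S - l₀ J ⪰ 0`
(`exists_congr_decomposition`). The identity block accounts for the infinite eigenvalues, the zero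
block for the common null space. Hence the finite eigenvalues are the `p + q` roots of
`det (S - λ J)` (`finiteEigenvalues_eq_roots`), and, as the identity block only adds a nonnegative
term to the form `A` and is not seen by the constraint, the minimization may be carried out for `S`
and `J` in place of `A` and `B`.

If `S - l₀ J` is positive definite, then `S` and `J` are simultaneously diagonalizable. By
Sylvester's law of inertia there are `p` eigenvalues of positive type, all at least `l₀`, and `q`
of negative type, all at most `l₀`. In eigenvector coordinates the lower bound for the trace is a
weighted Ky Fan inequality for matrices `P` with `Pᴴ P ⪰ 1` (`sum_mul_le_sum_mul_norm_sq`), and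
eigenvectors attain it. The semidefinite case follows by perturbation: the eigenvalues of
`S + ε - λ J` are bounded, a subsequence converges as `ε → 0`, and both the determinant and the two
bounds for the infimum pass to the limit (`exists_eigenvalues_of_posSemidef`).

If `D` has a negative eigenvalue and `A` is not a multiple of `B`, a feasible matrix can be moved
along a hyperbolic rotation, or in a direction of `ker B`, so that the column paired with this
eigenvalue has an arbitrarily large value of `C`, while the values at the other columns do not
change (`exists_large_frame`); the objective is then unbounded below.
-/

/-! ### Determinantal ideals and sorted eigenvalues -/

open Polynomial in
/-- If `A` and `B` come from smaller matrices `A₀`, `B₀` through one surjective `T` (with right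
inverse `W`), and `det (A₀ - λ B₀)` is not identically zero, then every minor of `A - λ B` of
maximal order is a scalar multiple of `det (A₀ - λ B₀)`, and some of these scalars are nonzero. So
this determinant generates the determinantal ideal. -/
theorem finiteEigenvalues_eq_roots {n : ℕ} {σ : Type*} [Fintype σ] [DecidableEq σ]
    {A B : Matrix (Fin n) (Fin n) ℂ} (T : Matrix σ (Fin n) ℂ) (W : Matrix (Fin n) σ ℂ)
    (A₀ B₀ : Matrix σ σ ℂ) (hTW : T * W = 1) (hA : A = Tᴴ * A₀ * T) (hB : B = Tᴴ * B₀ * T)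
    (p : ℂ[X]) (hp : ∀ l, p.eval l = (A₀ - l • B₀).det) (hp0 : p ≠ 0) :
    finiteEigenvalues A B = p.roots := by
  obtain ⟨l, hl⟩ : ∃ l, p.eval l ≠ 0 := by
    by_contra! h
    exact hp0 (Polynomial.funext fun l => by simp [h l])
  have hAB : ∀ l : ℂ, A - l • B = Tᴴ * (A₀ - l • B₀) * T := by
    intro l
    rw [hA, hB]
    simp [Matrix.mul_sub, Matrix.sub_mul]
  have hWT : Wᴴ * Tᴴ = 1 := by rw [← Matrix.conjTranspose_mul, hTW, Matrix.conjTranspose_one]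
  have hle : ∀ l : ℂ, (A - l • B).rank ≤ Fintype.card σ := by
    intro l
    rw [hAB]
    exact (Matrix.rank_mul_le_right _ _).trans (Matrix.rank_le_card_height _)
  have hge : Fintype.card σ ≤ (A - l • B).rank := by
    have h1 : A₀ - l • B₀ = Wᴴ * (A - l • B) * W := by
      rw [hAB]
      calc A₀ - l • B₀ = (Wᴴ * Tᴴ) * (A₀ - l • B₀) * (T * W) := by rw [hWT, hTW]; simp
        _ = _ := by simp only [Matrix.mul_assoc]
    rw [hp] at hl
    rw [← Matrix.rank_of_det_ne_zero hl, h1]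
    exact (Matrix.rank_mul_le_left _ _).trans (Matrix.rank_mul_le_right _ _)
  have hrank : normalRank A B = Fintype.card σ :=
    le_antisymm (ciSup_le hle) (hge.trans (rank_le_normalRank A B l))
  have e : Fin (normalRank A B) ≃ σ := (finCongr hrank).trans (Fintype.equivFin σ).symm
  have hminor : ∀ f g : Fin (normalRank A B) → Fin n,
      ((pencilMatrix A B).submatrix f g).det =
        C ((Tᴴ.submatrix f e).det * (T.submatrix e g).det) * p := by
    intro f g
    refine Polynomial.funext fun l => ?_
    rw [eval_minor, eval_mul, eval_C, hp, hAB, ← Matrix.submatrix_mul_equiv _ _ f e g,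
      ← Matrix.submatrix_mul_equiv _ _ f e e, Matrix.det_mul, Matrix.det_mul,
      Matrix.det_submatrix_equiv_self]
    ring
  obtain ⟨f, g, hfg⟩ := exists_minor_ne_zero (A - l • B) (hrank.trans_le hge)
  have hspan : determinantalIdeal A B = Ideal.span {p} := by
    apply le_antisymm
    · refine Ideal.span_le.mpr ?_
      rintro _ ⟨⟨f, g⟩, rfl⟩
      rw [SetLike.mem_coe, Ideal.mem_span_singleton]
      exact ⟨_, (hminor f g).trans (mul_comm _ _)⟩
    · rw [Ideal.span_singleton_le_iff_mem]
      have h1 : ((pencilMatrix A B).submatrix f g).det ∈ determinantalIdeal A B :=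
        Ideal.subset_span ⟨(f, g), rfl⟩
      have hc : (Tᴴ.submatrix f e).det * (T.submatrix e g).det ≠ 0 := by
        intro h0
        rw [← eval_minor, hminor, h0] at hfg
        simp at hfg
      have h2 := Ideal.mul_mem_left _ (C ((Tᴴ.submatrix f e).det * (T.submatrix e g).det)⁻¹) h1
      rwa [hminor, ← mul_assoc, ← C_mul, inv_mul_cancel₀ hc, C_1, one_mul] at h2
  have hassoc : Associated (Submodule.IsPrincipal.generator (determinantalIdeal A B)) p := by
    rw [← Ideal.span_singleton_eq_span_singleton, Ideal.span_singleton_generator, hspan]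
  exact hassoc.roots_eq


/-- A subspace (the range of `V`) on which `B` is positive meets a subspace (the kernel of `F`) on
which `B` is nonpositive only in `0`. -/
theorem card_le_of_pos_of_nonpos {ι α β : Type*} [Fintype ι] [Fintype α] [Fintype β]
    (B : Matrix ι ι ℂ) (V : Matrix ι α ℂ) (F : Matrix β ι ℂ)
    (hV : ∀ c : α → ℂ, c ≠ 0 → 0 < (star (V *ᵥ c) ⬝ᵥ B *ᵥ (V *ᵥ c)).re)
    (hF : ∀ x : ι → ℂ, F *ᵥ x = 0 → (star x ⬝ᵥ B *ᵥ x).re ≤ 0) :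
    Fintype.card α ≤ Fintype.card β := by
  have hinj : Function.Injective (F * V).mulVecLin := by
    rw [← LinearMap.ker_eq_bot, LinearMap.ker_eq_bot']
    intro c hc
    by_contra hne
    rw [Matrix.mulVecLin_apply, ← Matrix.mulVec_mulVec] at hc
    exact absurd (hF _ hc) (not_le.mpr (hV c hne))
  simpa using LinearMap.finrank_le_finrank_of_injective hinj

/-- In the sorted list of all values, the `q` values at most `l₀` come first, and those at least
`l₀` keep their order. -/
theorem getD_sort_eq {p q : ℕ} (s : Multiset ℝ) (l : Fin p ⊕ Fin q → ℝ) (l₀ : ℝ)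
    (hs : s = Finset.univ.val.map l) (hmono : Monotone (l ∘ Sum.inl))
    (hpos : ∀ i, l₀ ≤ l (Sum.inl i)) (hneg : ∀ i, l (Sum.inr i) ≤ l₀) (i : Fin p) :
    (s.sort (· ≤ ·)).getD (q + i) 0 = l (Sum.inl i) := by
  set N : List ℝ := ((Finset.univ : Finset (Fin q)).val.map (l ∘ Sum.inr)).sort (· ≤ ·) with hN
  have hlen : N.length = q := by simp [hN]
  have hsort : s.sort (· ≤ ·) = N ++ List.ofFn (l ∘ Sum.inl) := by
    refine List.Perm.eq_of_pairwise' (r := (· ≤ ·)) (Multiset.pairwise_sort _ _) ?_ ?_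
    · rw [List.pairwise_append]
      refine ⟨Multiset.pairwise_sort _ _, ?_, ?_⟩
      · rw [List.pairwise_ofFn]
        exact fun i j hij => hmono hij.le
      · intro a ha b hb
        rw [hN, Multiset.mem_sort, Multiset.mem_map] at ha
        obtain ⟨a, -, rfl⟩ := ha
        rw [List.mem_ofFn] at hb
        obtain ⟨b, rfl⟩ := hb
        exact (hneg a).trans (hpos b)
    · rw [← Multiset.coe_eq_coe, Multiset.sort_eq, ← Multiset.coe_add, hN, Multiset.sort_eq, hs]
      have h1 : (List.ofFn (l ∘ Sum.inl) : Multiset ℝ) =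
          (Finset.univ : Finset (Fin p)).val.map (l ∘ Sum.inl) := by
        rw [List.ofFn_eq_map, ← Multiset.map_coe]
        rfl
      rw [h1, ← Finset.univ_disjSum_univ, Finset.val_disjSum, Multiset.disjSum, Multiset.map_add,
        Multiset.map_map, Multiset.map_map, add_comm]
  rw [hsort, List.getD_append_right _ _ _ _ (by omega)]
  simp [hlen]

/-! ### Signatures and the law of inertia -/

/-- The signs `+1` (`p` times) and `-1` (`q` times). -/
noncomputable def inertiaSign {p q : ℕ} : Fin p ⊕ Fin q → ℝ := Sum.elim (fun _ => 1) (fun _ => -1)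

/-- The signature matrix `diag (I_p, -I_q)`. -/
noncomputable def signatureMatrix (p q : ℕ) : Matrix (Fin p ⊕ Fin q) (Fin p ⊕ Fin q) ℂ :=
  Matrix.diagonal fun x => (inertiaSign x : ℂ)

theorem inertiaSign_mul_self {p q : ℕ} (x : Fin p ⊕ Fin q) :
    inertiaSign x * inertiaSign x = 1 := by
  rcases x with x | x <;> simp [inertiaSign]

theorem re_quadForm_congr_diagonal {ι τ : Type*} [Fintype ι] [Fintype τ] [DecidableEq τ]
    (T : Matrix τ ι ℂ) (d : τ → ℝ) (x : ι → ℂ) :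
    (star x ⬝ᵥ (Tᴴ * Matrix.diagonal (fun y => (d y : ℂ)) * T) *ᵥ x).re =
      ∑ y, d y * ‖(T *ᵥ x) y‖ ^ 2 := by
  rw [← Matrix.mulVec_mulVec, ← Matrix.mulVec_mulVec, Matrix.dotProduct_mulVec,
    ← Matrix.star_mulVec, dotProduct, Complex.re_sum]
  refine Finset.sum_congr rfl fun y _ => ?_
  rw [Matrix.mulVec_diagonal, Pi.star_apply, mul_left_comm, Complex.star_def,
    Complex.conj_mul', ← Complex.ofReal_pow, ← Complex.ofReal_mul, Complex.ofReal_re]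

theorem card_pos_le_of_congr_eq {ι α β : Type*} [Fintype ι] [Fintype α] [Fintype β]
    [DecidableEq α] [DecidableEq β] [DecidableEq ι]
    (T₁ : Matrix α ι ℂ) (W₁ : Matrix ι α ℂ) (d₁ : α → ℝ) (T₂ : Matrix β ι ℂ) (d₂ : β → ℝ)
    (hTW : T₁ * W₁ = 1)
    (h : T₁ᴴ * Matrix.diagonal (fun y => (d₁ y : ℂ)) * T₁ =
      T₂ᴴ * Matrix.diagonal (fun y => (d₂ y : ℂ)) * T₂) :
    (Finset.univ.filter fun y => 0 < d₁ y).card ≤ (Finset.univ.filter fun y => 0 < d₂ y).card := by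
  classical
  rw [← Fintype.card_subtype, ← Fintype.card_subtype]
  refine card_le_of_pos_of_nonpos (T₁ᴴ * Matrix.diagonal (fun y => (d₁ y : ℂ)) * T₁)
    (W₁.submatrix id (Subtype.val : {y // 0 < d₁ y} → α))
    (T₂.submatrix (Subtype.val : {y // 0 < d₂ y} → β) id) ?_ ?_
  · intro c hc
    rw [re_quadForm_congr_diagonal]
    have h1 : ∀ y, (T₁ *ᵥ (W₁.submatrix id (Subtype.val : {y // 0 < d₁ y} → α) *ᵥ c)) y =
        if hy : 0 < d₁ y then c ⟨y, hy⟩ else 0 := by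
      intro y
      have h2 : T₁ * W₁.submatrix id (Subtype.val : {y // 0 < d₁ y} → α) =
          (1 : Matrix α α ℂ).submatrix id Subtype.val := by
        rw [← hTW, Matrix.submatrix_mul _ _ _ id _ Function.bijective_id, Matrix.submatrix_id_id]
      rw [Matrix.mulVec_mulVec, h2, Matrix.mulVec, dotProduct]
      split_ifs with hy
      · rw [Finset.sum_eq_single ⟨y, hy⟩]
        · rw [Matrix.submatrix_apply, id, Matrix.one_apply_eq, one_mul]
        · intro z _ hz
          simp [show y ≠ z.1 from fun h => hz (Subtype.ext h.symm)]
        · simp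
      · refine Finset.sum_eq_zero fun z _ => ?_
        simp [show y ≠ z.1 from fun h => hy (h ▸ z.2)]
    obtain ⟨z, hz⟩ := Function.ne_iff.mp hc
    refine Finset.sum_pos' (fun y _ => ?_) ⟨z.1, Finset.mem_univ _, ?_⟩
    · rw [h1]
      split_ifs with hy
      · positivity
      · simp
    · rw [h1, dif_pos z.2]
      have : 0 < ‖c z‖ := norm_pos_iff.mpr hz
      have := z.2
      positivity
  · intro x hx
    rw [h, re_quadForm_congr_diagonal]
    refine Finset.sum_nonpos fun y _ => ?_
    by_cases hy : 0 < d₂ y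
    · have h1 : (T₂ *ᵥ x) y = 0 := congrFun hx ⟨y, hy⟩
      simp [h1]
    · exact mul_nonpos_of_nonpos_of_nonneg (not_lt.mp hy) (by positivity)

theorem congr_diagonal_neg {ι τ : Type*} [Fintype τ] [DecidableEq τ] (T : Matrix τ ι ℂ)
    (d : τ → ℝ) : Tᴴ * Matrix.diagonal (fun y => ((-d y : ℝ) : ℂ)) * T =
      -(Tᴴ * Matrix.diagonal (fun y => (d y : ℂ)) * T) := by
  have h : Matrix.diagonal (fun y => ((-d y : ℝ) : ℂ)) = -Matrix.diagonal (fun y => (d y : ℂ)) := by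
    ext x y
    by_cases hxy : x = y <;> simp [hxy]
  rw [h, Matrix.mul_neg, Matrix.neg_mul]

/-- **Sylvester's law of inertia** for two diagonal representations `Tᴴ diag(d) T` of one Hermitian
matrix; the matrices `T` need only have right inverses, so zero entries may be split off. -/
theorem card_pos_eq_and_card_neg_eq_of_congr_eq {ι α β : Type*} [Fintype ι] [Fintype α]
    [Fintype β] [DecidableEq α] [DecidableEq β] [DecidableEq ι]
    (T₁ : Matrix α ι ℂ) (W₁ : Matrix ι α ℂ) (d₁ : α → ℝ)
    (T₂ : Matrix β ι ℂ) (W₂ : Matrix ι β ℂ) (d₂ : β → ℝ)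
    (hTW₁ : T₁ * W₁ = 1) (hTW₂ : T₂ * W₂ = 1)
    (h : T₁ᴴ * Matrix.diagonal (fun y => (d₁ y : ℂ)) * T₁ =
      T₂ᴴ * Matrix.diagonal (fun y => (d₂ y : ℂ)) * T₂) :
    (Finset.univ.filter fun y => 0 < d₁ y).card = (Finset.univ.filter fun y => 0 < d₂ y).card ∧
    (Finset.univ.filter fun y => d₁ y < 0).card = (Finset.univ.filter fun y => d₂ y < 0).card := by
  have h' := (congr_diagonal_neg T₁ d₁).trans
    ((congrArg Neg.neg h).trans (congr_diagonal_neg T₂ d₂).symm)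
  refine ⟨le_antisymm (card_pos_le_of_congr_eq T₁ W₁ d₁ T₂ d₂ hTW₁ h)
    (card_pos_le_of_congr_eq T₂ W₂ d₂ T₁ d₁ hTW₂ h.symm), ?_⟩
  have h1 := le_antisymm (card_pos_le_of_congr_eq T₁ W₁ _ T₂ _ hTW₁ h')
    (card_pos_le_of_congr_eq T₂ W₂ _ T₁ _ hTW₂ h'.symm)
  simpa using h1

/-- The indices with `b ≠ 0` can be listed with the positive ones first, and these in ascending
order of `v`. -/
theorem exists_sorted_enumeration {ι : Type*} [Fintype ι] (b v : ι → ℝ) {p q : ℕ}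
    (hp : (Finset.univ.filter fun y => 0 < b y).card = p)
    (hq : (Finset.univ.filter fun y => b y < 0).card = q) :
    ∃ e : Fin p ⊕ Fin q → ι, Function.Injective e ∧ (∀ y, b y ≠ 0 → y ∈ Set.range e) ∧
      (∀ x, 0 < inertiaSign x * b (e x)) ∧ Monotone (v ∘ e ∘ Sum.inl) := by
  classical
  rw [← Fintype.card_subtype] at hp hq
  let e₁ : Fin p ≃ {y // 0 < b y} := (Fintype.equivFinOfCardEq hp).symm
  let e₂ : Fin q ≃ {y // b y < 0} := (Fintype.equivFinOfCardEq hq).symm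
  let s := Tuple.sort fun i => v (e₁ i)
  refine ⟨Sum.elim (fun i => e₁ (s i)) (fun i => e₂ i), ?_, ?_, ?_, ?_⟩
  · refine Function.Injective.sumElim
      (Subtype.val_injective.comp (e₁.injective.comp s.injective))
      (Subtype.val_injective.comp e₂.injective) fun i j h => ?_
    have h1 := (e₁ (s i)).2
    have h2 := (e₂ j).2
    rw [h] at h1
    exact lt_asymm h1 h2
  · intro y hy
    rcases lt_or_gt_of_ne hy with h | h
    · exact ⟨Sum.inr (e₂.symm ⟨y, h⟩), by simp⟩
    · exact ⟨Sum.inl (s.symm (e₁.symm ⟨y, h⟩)), by simp⟩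
  · rintro (x | x)
    · simpa [inertiaSign] using (e₁ (s x)).2
    · simpa [inertiaSign] using (e₂ x).2
  · exact Tuple.monotone_sort fun i => v (e₁ i)

/-- A simultaneous diagonalization of `A` and `B` by congruence, rescaled so that `B` becomes the
signature matrix on the range of `W`; indices with `b = 0` are dropped. The eigenvalues `a / b` of
positive type are sorted and lie above the shift `l₀`, those of negative type lie below it. -/
theorem exists_signed_frame {ι : Type*} [Fintype ι] [DecidableEq ι] {A B U : Matrix ι ι ℂ}
    {a b : ι → ℝ} {p q : ℕ} {l₀ : ℝ} (hU : IsUnit U.det)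
    (hA : Uᴴ * A * U = Matrix.diagonal fun y => (a y : ℂ))
    (hB : Uᴴ * B * U = Matrix.diagonal fun y => (b y : ℂ))
    (hab : ∀ y, 0 ≤ a y - l₀ * b y)
    (hp : (Finset.univ.filter fun y => 0 < b y).card = p)
    (hq : (Finset.univ.filter fun y => b y < 0).card = q) :
    ∃ (T : Matrix (Fin p ⊕ Fin q) ι ℂ) (W : Matrix ι (Fin p ⊕ Fin q) ℂ) (e : Fin p ⊕ Fin q → ι)
      (l : Fin p ⊕ Fin q → ℝ),
      Function.Injective e ∧ (∀ y, b y ≠ 0 ↔ y ∈ Set.range e) ∧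
      T * W = 1 ∧ B = Tᴴ * signatureMatrix p q * T ∧
      (∀ x, l x = a (e x) / b (e x)) ∧
      A * W = B * W * Matrix.diagonal (fun x => (l x : ℂ)) ∧
      Monotone (l ∘ Sum.inl) ∧ (∀ i, l₀ ≤ l (Sum.inl i)) ∧ (∀ i, l (Sum.inr i) ≤ l₀) := by
  obtain ⟨e, he, hran, hsgn, hmono⟩ := exists_sorted_enumeration b (fun y => a y / b y) hp hq
  have hb0 : ∀ x, b (e x) ≠ 0 := fun x h => by simpa [h] using hsgn x
  have habs : ∀ x, |b (e x)| = inertiaSign x * b (e x) := by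
    intro x
    rw [← abs_of_pos (hsgn x), abs_mul]
    rcases x with x | x <;> simp [inertiaSign]
  have hUU : U * U⁻¹ = 1 := Matrix.mul_nonsing_inv U hU
  have hUU' : U⁻¹ * U = 1 := Matrix.nonsing_inv_mul U hU
  have hUH : (U⁻¹)ᴴ * Uᴴ = 1 := by
    rw [← Matrix.conjTranspose_mul, hUU, Matrix.conjTranspose_one]
  have hMU : ∀ {M : Matrix ι ι ℂ} {d : ι → ℝ}, Uᴴ * M * U = Matrix.diagonal (fun y => (d y : ℂ)) →
      M * U = (U⁻¹)ᴴ * Matrix.diagonal fun y => (d y : ℂ) := by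
    intro M d h
    rw [← h, Matrix.mul_assoc Uᴴ, ← Matrix.mul_assoc, hUH, Matrix.one_mul]
  have hsqrt : ∀ x, √|b (e x)| ≠ 0 := fun x => (Real.sqrt_pos.mpr (abs_pos.mpr (hb0 x))).ne'
  let r : Fin p ⊕ Fin q → ℂ := fun x => (√|b (e x)| : ℝ)
  have hr : ∀ x, r x ≠ 0 := fun x => Complex.ofReal_ne_zero.mpr (hsqrt x)
  -- the columns of `U` with `b ≠ 0`, scaled to `B`-norm `±1`, form `W`
  refine ⟨Matrix.diagonal r * U⁻¹.submatrix e id,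
    U.submatrix id e * Matrix.diagonal (fun x => (r x)⁻¹), e,
    fun x => a (e x) / b (e x), he, fun y => ⟨hran y, ?_⟩, ?_, ?_, fun _ => rfl, ?_, hmono, ?_, ?_⟩
  · rintro ⟨x, rfl⟩
    exact hb0 x
  · calc _ = Matrix.diagonal r * (U⁻¹.submatrix e id * U.submatrix id e) *
          Matrix.diagonal (fun x => (r x)⁻¹) := by simp only [Matrix.mul_assoc]
      _ = 1 := by
        rw [← Matrix.submatrix_mul _ _ _ id _ Function.bijective_id, hUU',
          Matrix.submatrix_one _ he, Matrix.mul_one, Matrix.diagonal_mul_diagonal]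
        simp [hr]
  · have h1 : B = (U⁻¹)ᴴ * Matrix.diagonal (fun y => (b y : ℂ)) * U⁻¹ := by
      rw [← hMU hB, Matrix.mul_assoc, hUU, Matrix.mul_one]
    rw [h1]
    ext i j
    rw [Matrix.mul_apply, Matrix.mul_apply]
    symm
    refine Fintype.sum_of_injective e he _ _ (fun y hy => ?_) fun x => ?_
    · have : b y = 0 := by
        by_contra h
        exact hy (hran y h)
      simp [this]
    · have h2 : r x * r x = inertiaSign x * b (e x) := by
        rw [← Complex.ofReal_mul, Real.mul_self_sqrt (abs_nonneg _), habs, Complex.ofReal_mul]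
      have h3 : star (r x) = r x := Complex.conj_ofReal _
      have h4 : (inertiaSign x : ℂ) * inertiaSign x = 1 := by
        rw [← Complex.ofReal_mul, inertiaSign_mul_self, Complex.ofReal_one]
      simp only [signatureMatrix, Matrix.conjTranspose_mul, Matrix.mul_diagonal,
        Matrix.diagonal_mul, Matrix.diagonal_conjTranspose, Matrix.conjTranspose_apply,
        Matrix.submatrix_apply, id, Pi.star_apply, h3]
      linear_combination (star (U⁻¹ (e x) i) * U⁻¹ (e x) j) * (inertiaSign x * h2 + b (e x) * h4)
  · have h1 : ∀ {M : Matrix ι ι ℂ}, M * (U.submatrix id e * Matrix.diagonal (fun x => (r x)⁻¹)) =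
        (M * U).submatrix id e * Matrix.diagonal (fun x => (r x)⁻¹) := by
      intro M
      rw [← Matrix.mul_assoc]
      rfl
    rw [h1, h1, hMU hA, hMU hB]
    ext i x
    have h2 : (b (e x) : ℂ) ≠ 0 := Complex.ofReal_ne_zero.mpr (hb0 x)
    simp only [Matrix.mul_diagonal, Matrix.submatrix_apply, id, Complex.ofReal_div]
    field_simp
  · intro i
    have h1 : 0 < b (e (Sum.inl i)) := by simpa [inertiaSign] using hsgn (Sum.inl i)
    rw [le_div_iff₀ h1]
    linarith [hab (e (Sum.inl i))]
  · intro i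
    have h1 : b (e (Sum.inr i)) < 0 := by simpa [inertiaSign] using hsgn (Sum.inr i)
    rw [div_le_iff_of_neg h1]
    linarith [hab (e (Sum.inr i))]

/-! ### A weighted Ky Fan inequality -/

/-- Abel summation: nonnegative prefix sums suffice against antitone nonnegative weights. -/
theorem sum_mul_nonneg_of_antitone : ∀ {k : ℕ} (w d : Fin k → ℝ), Antitone w → (∀ j, 0 ≤ w j) →
    (∀ m ≤ k, 0 ≤ ∑ j : Fin k, if (j : ℕ) < m then d j else 0) → 0 ≤ ∑ j, w j * d j
  | 0, _, _, _, _, _ => by simp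
  | k + 1, w, d, hw, hw0, hd => by
    have h1 := sum_mul_nonneg_of_antitone (fun j : Fin k => w j.castSucc - w (Fin.last k))
      (fun j => d j.castSucc)
      (fun i j hij => sub_le_sub_right (hw (Fin.castSucc_le_castSucc_iff.mpr hij)) _)
      (fun j => sub_nonneg.mpr (hw (Fin.le_last _))) (fun m hm => by
        have := hd m (hm.trans (Nat.le_succ k))
        rw [Fin.sum_univ_castSucc] at this
        simpa [not_lt.mpr hm] using this)
    have h2 := mul_nonneg (hw0 (Fin.last k)) (hd (k + 1) le_rfl)
    simp only [Fin.is_lt, if_true] at h2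
    rw [Fin.sum_univ_castSucc] at h2 ⊢
    have h3 : ∑ j : Fin k, (w j.castSucc - w (Fin.last k)) * d j.castSucc =
        ∑ j : Fin k, w j.castSucc * d j.castSucc - w (Fin.last k) * ∑ j : Fin k, d j.castSucc := by
      rw [Finset.mul_sum, ← Finset.sum_sub_distrib]
      exact Finset.sum_congr rfl fun j _ => sub_mul _ _ _
    linarith

/-- Abel summation: nonnegative suffix sums suffice against monotone nonnegative weights. -/
theorem sum_mul_nonneg_of_monotone : ∀ {p : ℕ} (w d : Fin p → ℝ), Monotone w → (∀ a, 0 ≤ w a) →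
    (∀ t ≤ p, 0 ≤ ∑ a : Fin p, if t ≤ (a : ℕ) then d a else 0) → 0 ≤ ∑ a, w a * d a
  | 0, _, _, _, _, _ => by simp
  | p + 1, w, d, hw, hw0, hd => by
    have h1 := sum_mul_nonneg_of_monotone (fun a : Fin p => w a.succ - w 0)
      (fun a => d a.succ)
      (fun i j hij => sub_le_sub_right (hw (Fin.succ_le_succ_iff.mpr hij)) _)
      (fun a => sub_nonneg.mpr (hw (Fin.zero_le _))) (fun t ht => by
        have := hd (t + 1) (Nat.succ_le_succ ht)
        rw [Fin.sum_univ_succ] at this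
        simpa using this)
    have h2 := mul_nonneg (hw0 0) (hd 0 (Nat.zero_le _))
    simp only [Nat.zero_le, if_true] at h2
    rw [Fin.sum_univ_succ] at h2 ⊢
    have h3 : ∑ a : Fin p, (w a.succ - w 0) * d a.succ =
        ∑ a : Fin p, w a.succ * d a.succ - w 0 * ∑ a : Fin p, d a.succ := by
      rw [Finset.mul_sum, ← Finset.sum_sub_distrib]
      exact Finset.sum_congr rfl fun j _ => sub_mul _ _ _
    linarith

theorem conjTranspose_eigenvectorUnitary_mul_mul {ι : Type*} [Fintype ι] [DecidableEq ι]
    {G : Matrix ι ι ℂ} (hG : G.IsHermitian) :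
    (hG.eigenvectorUnitary : Matrix ι ι ℂ)ᴴ * G * (hG.eigenvectorUnitary : Matrix ι ι ℂ) =
      Matrix.diagonal fun y => (hG.eigenvalues y : ℂ) := by
  have h := hG.conjStarAlgAut_star_eigenvectorUnitary
  rw [Unitary.conjStarAlgAut_apply] at h
  simpa [Matrix.star_eq_conjTranspose, Function.comp_def] using h

/-- In an eigenbasis of `G`, every eigenvector for the eigenvalue `0` contributes at least `1` to
the trace of `H`, because `G + H ⪰ 1`. -/
theorem card_sub_rank_le_trace {ι : Type*} [Fintype ι] [DecidableEq ι] {G H : Matrix ι ι ℂ}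
    (hG : G.IsHermitian) (hH : H.PosSemidef) (hGH : (G + H - 1).PosSemidef) :
    (Fintype.card ι : ℝ) - G.rank ≤ H.trace.re := by
  set V : Matrix ι ι ℂ := hG.eigenvectorUnitary.1 with hV
  have hVG : Vᴴ * G * V = _ := conjTranspose_eigenvectorUnitary_mul_mul hG
  have hVV' : Vᴴ * V = 1 := (Matrix.mem_unitaryGroup_iff').mp hG.eigenvectorUnitary.2
  have hVV : V * Vᴴ = 1 := (Matrix.mem_unitaryGroup_iff).mp hG.eigenvectorUnitary.2
  have h1 : H.trace = (Vᴴ * H * V).trace := by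
    rw [Matrix.trace_mul_cycle, hVV, Matrix.one_mul]
  have h2 : ∀ i, (if hG.eigenvalues i ≠ 0 then (0 : ℝ) else 1) ≤ ((Vᴴ * H * V) i i).re := by
    intro i
    split_ifs with hi
    · exact (Complex.le_def.mp (hH.conjTranspose_mul_mul_same V).diag_nonneg).1
    · have h3 := (Complex.le_def.mp ((hGH.conjTranspose_mul_mul_same V).diag_nonneg (i := i))).1
      rw [Matrix.mul_sub, Matrix.sub_mul, Matrix.mul_add, Matrix.add_mul, hVG, Matrix.mul_one,
        hVV'] at h3
      simp only [ne_eq, not_not] at hi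
      simp [hi] at h3
      exact h3
  have h4 : (Fintype.card ι : ℝ) - G.rank = ∑ i, if hG.eigenvalues i ≠ 0 then (0 : ℝ) else 1 := by
    have h5 : (G.rank : ℝ) = ∑ i, if hG.eigenvalues i ≠ 0 then (1 : ℝ) else 0 := by
      rw [hG.rank_eq_card_non_zero_eigs, Fintype.card_subtype, Finset.sum_boole]
    rw [h5, ← Finset.card_univ, Finset.cast_card, ← Finset.sum_sub_distrib]
    refine Finset.sum_congr rfl fun i _ => ?_
    split_ifs <;> simp
  rw [h4, h1, Matrix.trace, Complex.re_sum]
  exact Finset.sum_le_sum fun i _ => h2 i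

/-- If `Pᴴ P ⪰ 1`, then deleting `r` rows of `P` leaves a matrix whose squared Frobenius norm is at
least the number of columns minus `r`. -/
theorem card_sub_card_le_sum_norm_sq {α ι : Type*} [Fintype α] [Fintype ι] [DecidableEq α]
    [DecidableEq ι] (P : Matrix α ι ℂ) (hP : (Pᴴ * P - 1).PosSemidef) (s : α → Prop)
    [DecidablePred s] :
    (Fintype.card ι : ℝ) - (Finset.univ.filter fun a => ¬ s a).card ≤
      ∑ j, ∑ a, if s a then ‖P a j‖ ^ 2 else 0 := by
  let d : α → ℂ := fun a => if s a then 1 else 0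
  let d' : α → ℂ := fun a => if s a then 0 else 1
  have hadd : Pᴴ * Matrix.diagonal d' * P + Pᴴ * Matrix.diagonal d * P = Pᴴ * P := by
    rw [← Matrix.add_mul, ← Matrix.mul_add, Matrix.diagonal_add]
    have : (fun a => d' a + d a) = fun _ => 1 := by
      ext a
      by_cases h : s a <;> simp [d, d', h]
    rw [this, Matrix.diagonal_one, Matrix.mul_one]
  have hd : (Matrix.diagonal d).PosSemidef := Matrix.PosSemidef.diagonal fun a => by
    by_cases h : s a <;> simp [d, h]
  have hd' : (Matrix.diagonal d').PosSemidef := Matrix.PosSemidef.diagonal fun a => by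
    by_cases h : s a <;> simp [d', h]
  have h1 := card_sub_rank_le_trace (hd'.conjTranspose_mul_mul_same P).isHermitian
    (hd.conjTranspose_mul_mul_same P) (by rwa [hadd])
  have h2 : (Pᴴ * Matrix.diagonal d' * P).rank ≤ (Finset.univ.filter fun a => ¬ s a).card := by
    refine (Matrix.rank_mul_le_left _ _).trans ((Matrix.rank_mul_le_right _ _).trans ?_)
    rw [Matrix.rank_diagonal, Fintype.card_subtype]
    refine Finset.card_le_card fun a => ?_
    simp [d']
  have h3 : (Pᴴ * Matrix.diagonal d * P).trace.re = ∑ j, ∑ a, if s a then ‖P a j‖ ^ 2 else 0 := by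
    rw [Matrix.trace, Complex.re_sum]
    refine Finset.sum_congr rfl fun j _ => ?_
    rw [Matrix.diag_apply, Matrix.mul_apply, Complex.re_sum]
    refine Finset.sum_congr rfl fun a _ => ?_
    rw [Matrix.mul_diagonal, Matrix.conjTranspose_apply]
    by_cases h : s a
    · simp only [d, h, if_true, mul_one]
      rw [Complex.star_def, Complex.conj_mul', ← Complex.ofReal_pow, Complex.ofReal_re]
    · simp [d, h]
  rw [← h3]
  have h4 : ((Pᴴ * Matrix.diagonal d' * P).rank : ℝ) ≤
      (Finset.univ.filter fun a => ¬ s a).card := by exact_mod_cast h2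
  linarith

/-- A weighted Ky Fan inequality for matrices with `Pᴴ P ⪰ 1`. Summation by parts in both `w` and
`α` reduces it to the squared Frobenius norms of the blocks of `P` made of the first `m` columns and
all but the first `t` rows. -/
theorem sum_mul_le_sum_mul_norm_sq {p k : ℕ} (hk : k ≤ p) (P : Matrix (Fin p) (Fin k) ℂ)
    (hP : (Pᴴ * P - 1).PosSemidef) (w : Fin k → ℝ) (α : Fin p → ℝ) (hw : Antitone w)
    (hw0 : ∀ j, 0 ≤ w j) (hα : Monotone α) (hα0 : ∀ a, 0 ≤ α a) :
    ∑ j, w j * α (Fin.castLE hk j) ≤ ∑ j, w j * ∑ a, α a * ‖P a j‖ ^ 2 := by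
  rw [← sub_nonneg, ← Finset.sum_sub_distrib]
  simp only [← mul_sub]
  refine sum_mul_nonneg_of_antitone w _ hw hw0 fun m hm => ?_
  have h1 : ∑ j : Fin k, (if (j : ℕ) < m then
        ∑ a, α a * ‖P a j‖ ^ 2 - α (Fin.castLE hk j) else 0) =
      ∑ a, α a * (∑ j : Fin k, (if (j : ℕ) < m then ‖P a j‖ ^ 2 else 0) -
        if (a : ℕ) < m then 1 else 0) := by
    simp only [mul_sub, Finset.sum_sub_distrib, Finset.mul_sum]
    rw [Finset.sum_comm]
    have h2 : ∀ j : Fin k, (if (j : ℕ) < m then ∑ a, α a * ‖P a j‖ ^ 2 - α (Fin.castLE hk j)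
        else 0) = ∑ a, α a * (if (j : ℕ) < m then ‖P a j‖ ^ 2 else 0) -
          if (j : ℕ) < m then α (Fin.castLE hk j) else 0 := by
      intro j
      split_ifs <;> simp
    simp only [h2, Finset.sum_sub_distrib]
    congr 1
    refine Fintype.sum_of_injective _ (Fin.castLE_injective hk) _ _ (fun a ha => ?_) fun j => ?_
    · have : ¬ (a : ℕ) < m := fun h => ha ⟨⟨a, h.trans_le hm⟩, rfl⟩
      simp [this]
    · simp
  rw [h1]
  refine sum_mul_nonneg_of_monotone α _ hα hα0 fun t ht => ?_
  have h3 := card_sub_card_le_sum_norm_sq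
    (P.submatrix id (Subtype.val : {j : Fin k // (j : ℕ) < m} → Fin k)) (by
      have := hP.submatrix (Subtype.val : {j : Fin k // (j : ℕ) < m} → Fin k)
      have h2 : ∀ (M N : Matrix (Fin k) (Fin k) ℂ) (f : {j : Fin k // (j : ℕ) < m} → Fin k),
        (M - N).submatrix f f = M.submatrix f f - N.submatrix f f := fun _ _ _ => rfl
      rwa [h2, Matrix.submatrix_one _ Subtype.val_injective,
        Matrix.submatrix_mul _ _ _ id _ Function.bijective_id] at this) (fun a => t ≤ (a : ℕ))
  have hcard : ∀ {r s : ℕ}, s ≤ r → (Finset.univ.filter fun j : Fin r => (j : ℕ) < s).card = s := by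
    intro r s hs
    simp [Fin.card_filter_val_lt, hs]
  have h4 : (Fintype.card {j : Fin k // (j : ℕ) < m} : ℝ) = m := by
    rw [Fintype.card_subtype, hcard hm]
  have h5 : ((Finset.univ.filter fun a : Fin p => ¬ t ≤ (a : ℕ)).card : ℝ) = t := by
    simp only [not_le]
    rw [hcard ht]
  have h6 : ∑ j : {j : Fin k // (j : ℕ) < m}, ∑ a : Fin p, (if t ≤ (a : ℕ) then
      ‖P.submatrix id (Subtype.val : {j : Fin k // (j : ℕ) < m} → Fin k) a j‖ ^ 2 else 0) =
      ∑ a : Fin p, if t ≤ (a : ℕ) then ∑ j : Fin k, (if (j : ℕ) < m then ‖P a j‖ ^ 2 else 0)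
        else 0 := by
    rw [Finset.sum_comm]
    refine Finset.sum_congr rfl fun a _ => ?_
    split_ifs
    · rw [← Finset.sum_filter]
      exact (Finset.sum_subtype (Finset.univ.filter fun j : Fin k => (j : ℕ) < m)
        (fun j => by simp) fun j => ‖P a j‖ ^ 2).symm
    · simp
  rw [h4, h5, h6] at h3
  have h7 : ∑ a : Fin p, (if t ≤ (a : ℕ) then (if (a : ℕ) < m then (1 : ℝ) else 0) else 0) =
      ((m - t : ℕ) : ℝ) := by
    have h8 := Fin.sum_univ_eq_sum_range
      (fun a => if t ≤ a then (if a < m then (1 : ℝ) else 0) else 0) p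
    rw [h8]
    simp only [← ite_and, Finset.sum_boole]
    congr 1
    rw [← Nat.card_Ico]
    congr 1
    ext a
    simp only [Finset.mem_filter, Finset.mem_range, Finset.mem_Ico]
    omega
  have h8 : 0 ≤ ∑ a : Fin p, if t ≤ (a : ℕ) then
      ∑ j : Fin k, (if (j : ℕ) < m then ‖P a j‖ ^ 2 else 0) else 0 :=
    Finset.sum_nonneg fun a _ => by split_ifs <;> positivity
  have h9 : ∀ a : Fin p, (if t ≤ (a : ℕ) then
      ∑ j : Fin k, (if (j : ℕ) < m then ‖P a j‖ ^ 2 else 0) - (if (a : ℕ) < m then 1 else 0) else 0)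
      = (if t ≤ (a : ℕ) then ∑ j : Fin k, (if (j : ℕ) < m then ‖P a j‖ ^ 2 else 0) else 0) -
        (if t ≤ (a : ℕ) then (if (a : ℕ) < m then (1 : ℝ) else 0) else 0) := by
    intro a
    split_ifs <;> simp
  rw [Finset.sum_congr rfl fun a _ => h9 a, Finset.sum_sub_distrib, h7]
  rcases le_total t m with htm | htm
  · rw [Nat.cast_sub htm]
    linarith
  · rw [Nat.sub_eq_zero_of_le htm]
    simpa using h8

/-! ### Definite pencils with a signature matrix -/

theorem re_conjTranspose_mul_diagonal_mul_apply {τ κ : Type*} [Fintype τ] [DecidableEq τ]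
    (Z : Matrix τ κ ℂ) (d : τ → ℝ) (j : κ) :
    ((Zᴴ * Matrix.diagonal (fun x => (d x : ℂ)) * Z) j j).re = ∑ x, d x * ‖Z x j‖ ^ 2 := by
  rw [Matrix.mul_apply, Complex.re_sum]
  refine Finset.sum_congr rfl fun x _ => ?_
  rw [Matrix.mul_diagonal, Matrix.conjTranspose_apply, mul_right_comm, Complex.star_def,
    Complex.conj_mul', ← Complex.ofReal_pow, ← Complex.ofReal_mul, Complex.ofReal_re, mul_comm]

theorem isHermitian_signatureMatrix (p q : ℕ) : (signatureMatrix p q).IsHermitian := by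
  refine Matrix.isHermitian_diagonal_of_self_adjoint _ ?_
  ext x
  simp

theorem signatureMatrix_mul_self (p q : ℕ) : signatureMatrix p q * signatureMatrix p q = 1 := by
  rw [signatureMatrix, Matrix.diagonal_mul_diagonal, ← Matrix.diagonal_one]
  congr 1
  ext x
  rw [← Complex.ofReal_mul, inertiaSign_mul_self, Complex.ofReal_one]

theorem card_inertiaSign_pos (p q : ℕ) :
    (Finset.univ.filter fun x : Fin p ⊕ Fin q => 0 < inertiaSign x).card = p := by
  rw [Finset.card_filter, Fintype.sum_sum_type]
  simp [inertiaSign, not_lt.mpr (zero_le_one' ℝ)]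

theorem card_inertiaSign_neg (p q : ℕ) :
    (Finset.univ.filter fun x : Fin p ⊕ Fin q => inertiaSign x < 0).card = q := by
  rw [Finset.card_filter, Fintype.sum_sum_type]
  simp [inertiaSign, not_lt.mpr (zero_le_one' ℝ)]

theorem exists_congr_one_and_diagonal {ι : Type*} [Fintype ι] [DecidableEq ι] {G B : Matrix ι ι ℂ}
    (hG : G.PosDef) (hB : B.IsHermitian) :
    ∃ (U : Matrix ι ι ℂ) (b : ι → ℝ), IsUnit U.det ∧ Uᴴ * G * U = 1 ∧
      Uᴴ * B * U = Matrix.diagonal fun y => (b y : ℂ) := by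
  obtain ⟨R, hR, hRG⟩ : ∃ R : Matrix ι ι ℂ, IsUnit R.det ∧ Rᴴ * G * R = 1 := by
    obtain ⟨V, g, hV, hg, h⟩ : ∃ (V : Matrix ι ι ℂ) (g : ι → ℝ), IsUnit V.det ∧ (∀ i, 0 < g i) ∧
        Vᴴ * G * V = Matrix.diagonal fun y => (g y : ℂ) :=
      ⟨_, _, Matrix.UnitaryGroup.det_isUnit hG.1.eigenvectorUnitary, hG.eigenvalues_pos,
        conjTranspose_eigenvectorUnitary_mul_mul hG.1⟩
    have hg0 : ∀ i, (√(g i) : ℂ) ≠ 0 := fun i =>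
      Complex.ofReal_ne_zero.mpr (Real.sqrt_pos.mpr (hg i)).ne'
    refine ⟨V * Matrix.diagonal fun i => (√(g i) : ℂ)⁻¹, ?_, ?_⟩
    · rw [Matrix.det_mul, Matrix.det_diagonal]
      exact hV.mul (Finset.prod_ne_zero_iff.mpr fun i _ => inv_ne_zero (hg0 i)).isUnit
    · rw [Matrix.conjTranspose_mul]
      calc _ = (Matrix.diagonal fun i => (√(g i) : ℂ)⁻¹)ᴴ * (Vᴴ * G * V) *
            Matrix.diagonal fun i => (√(g i) : ℂ)⁻¹ := by simp only [Matrix.mul_assoc]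
        _ = 1 := by
          rw [h, Matrix.diagonal_conjTranspose, Matrix.diagonal_mul_diagonal,
            Matrix.diagonal_mul_diagonal, ← Matrix.diagonal_one]
          congr 1
          ext i
          have h2 : (g i : ℂ) = √(g i) * √(g i) := by
            rw [← Complex.ofReal_mul, Real.mul_self_sqrt (hg i).le]
          have := hg0 i
          rw [Pi.star_apply, star_inv₀, Complex.star_def, Complex.conj_ofReal]
          field_simp
          rw [sq, ← h2]
  have hC : (Rᴴ * B * R).IsHermitian := Matrix.isHermitian_conjTranspose_mul_mul R hB
  refine ⟨R * hC.eigenvectorUnitary.1, hC.eigenvalues, ?_, ?_, ?_⟩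
  · rw [Matrix.det_mul]
    exact hR.mul (Matrix.UnitaryGroup.det_isUnit hC.eigenvectorUnitary)
  · calc _ = hC.eigenvectorUnitary.1ᴴ * (Rᴴ * G * R) * hC.eigenvectorUnitary.1 := by
          rw [Matrix.conjTranspose_mul]; simp only [Matrix.mul_assoc]
      _ = 1 := by
        rw [hRG, Matrix.mul_one]
        exact (Matrix.mem_unitaryGroup_iff').mp hC.eigenvectorUnitary.2
  · rw [← conjTranspose_eigenvectorUnitary_mul_mul hC, Matrix.conjTranspose_mul]
    simp only [Matrix.mul_assoc]

/-- A definite pencil `S - λ J` has a full set of `J`-orthonormal eigenvectors, the columns of `W`;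
by the law of inertia they have the same signature as `J`. -/
theorem exists_frame_of_posDef {p q : ℕ} {S : Matrix (Fin p ⊕ Fin q) (Fin p ⊕ Fin q) ℂ} {l₀ : ℝ}
    (hS : (S - (l₀ : ℂ) • signatureMatrix p q).PosDef) :
    ∃ (W : Matrix (Fin p ⊕ Fin q) (Fin p ⊕ Fin q) ℂ) (l : Fin p ⊕ Fin q → ℝ),
      IsUnit W ∧ Wᴴ * signatureMatrix p q * W = signatureMatrix p q ∧
      S * W = signatureMatrix p q * W * Matrix.diagonal (fun x => (l x : ℂ)) ∧
      Monotone (l ∘ Sum.inl) ∧ (∀ i, l₀ ≤ l (Sum.inl i)) ∧ (∀ i, l (Sum.inr i) ≤ l₀) := by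
  obtain ⟨U, b, hU, hUG, hUJ⟩ := exists_congr_one_and_diagonal hS (isHermitian_signatureMatrix p q)
  have hUS : Uᴴ * S * U = Matrix.diagonal fun y => ((1 + l₀ * b y : ℝ) : ℂ) := by
    rw [Matrix.mul_sub, Matrix.sub_mul, sub_eq_iff_eq_add, Matrix.mul_smul, Matrix.smul_mul,
      hUJ] at hUG
    rw [hUG, ← Matrix.diagonal_one, ← Matrix.diagonal_smul, Matrix.diagonal_add]
    congr 1
    ext y
    simp
  have hUU : U * U⁻¹ = 1 := Matrix.mul_nonsing_inv U hU
  have hUH : (U⁻¹)ᴴ * Uᴴ = 1 := by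
    rw [← Matrix.conjTranspose_mul, hUU, Matrix.conjTranspose_one]
  have hin := card_pos_eq_and_card_neg_eq_of_congr_eq
    (1 : Matrix (Fin p ⊕ Fin q) (Fin p ⊕ Fin q) ℂ) 1 inertiaSign U⁻¹ U b (Matrix.mul_one 1)
    (Matrix.nonsing_inv_mul U hU) (by
      rw [← hUJ]
      calc _ = signatureMatrix p q := by simp [signatureMatrix]
        _ = ((U⁻¹)ᴴ * Uᴴ) * signatureMatrix p q * (U * U⁻¹) := by rw [hUH, hUU]; simp
        _ = _ := by simp only [Matrix.mul_assoc])
  rw [card_inertiaSign_pos, card_inertiaSign_neg] at hin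
  obtain ⟨T, W, -, l, -, -, hTW, hJ, -, hSW, hmono, hpos, hneg⟩ :=
    exists_signed_frame (l₀ := l₀) hU hUS hUJ (fun y => by simp) hin.1.symm hin.2.symm
  refine ⟨W, l, IsUnit.of_mul_eq_one_right _ hTW, ?_, hSW, hmono, hpos, hneg⟩
  have hWT : Wᴴ * Tᴴ = 1 := by rw [← Matrix.conjTranspose_mul, hTW, Matrix.conjTranspose_one]
  calc Wᴴ * signatureMatrix p q * W = Wᴴ * (Tᴴ * signatureMatrix p q * T) * W := by rw [← hJ]
    _ = (Wᴴ * Tᴴ) * signatureMatrix p q * (T * W) := by simp only [Matrix.mul_assoc]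
    _ = _ := by rw [hWT, hTW]; simp

section frame

variable {p q : ℕ} {S W : Matrix (Fin p ⊕ Fin q) (Fin p ⊕ Fin q) ℂ} {l : Fin p ⊕ Fin q → ℝ}

theorem det_sub_smul_of_frame (hW : IsUnit W)
    (hSW : S * W = signatureMatrix p q * W * Matrix.diagonal (fun x => (l x : ℂ))) (z : ℂ) :
    (S - z • signatureMatrix p q).det = (signatureMatrix p q).det * ∏ x, ((l x : ℂ) - z) := by
  have h1 : (S - z • signatureMatrix p q) * W =
      signatureMatrix p q * W * Matrix.diagonal (fun x => (l x : ℂ) - z) := by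
    have h2 : Matrix.diagonal (fun x => (l x : ℂ) - z) = Matrix.diagonal (fun x => (l x : ℂ)) -
        z • (1 : Matrix (Fin p ⊕ Fin q) (Fin p ⊕ Fin q) ℂ) := by
      rw [← Matrix.diagonal_one, ← Matrix.diagonal_smul, Matrix.diagonal_sub]
      congr 1
      ext x
      simp
    rw [h2, Matrix.mul_sub, Matrix.sub_mul, hSW]
    simp
  have h3 := congrArg Matrix.det h1
  rw [Matrix.det_mul, Matrix.det_mul, Matrix.det_mul, Matrix.det_diagonal] at h3
  have h4 : W.det ≠ 0 := ((Matrix.isUnit_iff_isUnit_det W).mp hW).ne_zero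
  apply mul_right_cancel₀ h4
  rw [h3]
  ring

/-- The eigenvalues are bounded by the entries of `S` alone: compare both sides of `S w = l J w` in
the coordinate in which `w` is largest. -/
theorem abs_le_sum_norm_of_frame (hW : IsUnit W)
    (hSW : S * W = signatureMatrix p q * W * Matrix.diagonal (fun x => (l x : ℂ)))
    (x : Fin p ⊕ Fin q) : |l x| ≤ ∑ i, ∑ j, ‖S i j‖ := by
  have : Nonempty (Fin p ⊕ Fin q) := ⟨x⟩
  obtain ⟨i, hi⟩ := Finite.exists_max fun i => ‖W i x‖
  have hpos : 0 < ‖W i x‖ := by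
    by_contra h
    have h0 : ∀ j, W j x = 0 := fun j =>
      norm_eq_zero.mp (le_antisymm ((hi j).trans (not_lt.mp h)) (norm_nonneg _))
    exact ((Matrix.isUnit_iff_isUnit_det W).mp hW).ne_zero
      (Matrix.det_eq_zero_of_column_eq_zero x h0)
  have h1 := congrFun (congrFun hSW i) x
  rw [Matrix.mul_diagonal, signatureMatrix, Matrix.diagonal_mul, Matrix.mul_apply] at h1
  have h2 : ‖(inertiaSign i : ℂ)‖ = 1 := by rcases i with i | i <;> simp [inertiaSign]
  have h3 := congrArg norm h1
  rw [norm_mul, norm_mul, h2, one_mul, Complex.norm_real, Real.norm_eq_abs] at h3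
  have h4 : ‖∑ j, S i j * W j x‖ ≤ (∑ j, ‖S i j‖) * ‖W i x‖ := by
    rw [Finset.sum_mul]
    refine norm_sum_le_of_le _ fun j _ => ?_
    rw [norm_mul]
    exact mul_le_mul_of_nonneg_left (hi j) (norm_nonneg _)
  rw [h3, mul_comm] at h4
  refine (le_of_mul_le_mul_right h4 hpos).trans ?_
  exact Finset.single_le_sum (f := fun i => ∑ j, ‖S i j‖)
    (fun i _ => Finset.sum_nonneg fun j _ => norm_nonneg _) (Finset.mem_univ i)

theorem conjTranspose_mul_mul_of_frame {k : ℕ}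
    (hWJ : Wᴴ * signatureMatrix p q * W = signatureMatrix p q)
    (hSW : S * W = signatureMatrix p q * W * Matrix.diagonal (fun x => (l x : ℂ)))
    (Z : Matrix (Fin p ⊕ Fin q) (Fin k) ℂ) :
    (W * Z)ᴴ * S * (W * Z) =
      Zᴴ * Matrix.diagonal (fun x => ((inertiaSign x * l x : ℝ) : ℂ)) * Z := by
  have h : Wᴴ * S * W = Matrix.diagonal (fun x => ((inertiaSign x * l x : ℝ) : ℂ)) := by
    rw [Matrix.mul_assoc, hSW, ← Matrix.mul_assoc, ← Matrix.mul_assoc, hWJ, signatureMatrix,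
      Matrix.diagonal_mul_diagonal]
    simp
  rw [← h, Matrix.conjTranspose_mul]
  simp only [Matrix.mul_assoc]

/-- The lower bound for a definite pencil. In eigenvector coordinates `Y = W Z`, the constraint
reads `Pᴴ P - Nᴴ N = 1` for the two row blocks of `Z`. After the shift by `l₀` the block `N`
contributes nonnegatively, and the weighted Ky Fan inequality applies to `P`. -/
theorem weighted_sum_le_of_frame {k : ℕ} (hk : k ≤ p) {l₀ : ℝ} (hW : IsUnit W)
    (hWJ : Wᴴ * signatureMatrix p q * W = signatureMatrix p q)
    (hSW : S * W = signatureMatrix p q * W * Matrix.diagonal (fun x => (l x : ℂ)))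
    (hmono : Monotone (l ∘ Sum.inl)) (hpos : ∀ i, l₀ ≤ l (Sum.inl i))
    (hneg : ∀ i, l (Sum.inr i) ≤ l₀) {w : Fin k → ℝ} (hw : Antitone w) (hw0 : ∀ j, 0 ≤ w j)
    {Y : Matrix (Fin p ⊕ Fin q) (Fin k) ℂ} (hY : Yᴴ * signatureMatrix p q * Y = 1) :
    ∑ j, w j * l (Sum.inl (Fin.castLE hk j)) ≤ ∑ j, w j * ((Yᴴ * S * Y) j j).re := by
  obtain ⟨T, hWT⟩ := hW.exists_right_inv
  obtain ⟨Z, rfl⟩ : ∃ Z, Y = W * Z := ⟨T * Y, by rw [← Matrix.mul_assoc, hWT, Matrix.one_mul]⟩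
  have hZ : Zᴴ * signatureMatrix p q * Z = 1 := by
    rw [← hY]
    nth_rewrite 1 [← hWJ]
    rw [Matrix.conjTranspose_mul]
    simp only [Matrix.mul_assoc]
  have hnorm : ∀ j, ∑ a, ‖Z (Sum.inl a) j‖ ^ 2 - ∑ b, ‖Z (Sum.inr b) j‖ ^ 2 = 1 := by
    intro j
    have h1 := re_conjTranspose_mul_diagonal_mul_apply Z inertiaSign j
    rw [← signatureMatrix, hZ, Fintype.sum_sum_type] at h1
    simp [inertiaSign] at h1
    linarith
  have hP : ((Z.submatrix Sum.inl id)ᴴ * Z.submatrix Sum.inl id - 1).PosSemidef := by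
    have h1 : (Z.submatrix Sum.inl id)ᴴ * Z.submatrix Sum.inl id - 1 =
        (Z.submatrix Sum.inr id)ᴴ * Z.submatrix Sum.inr id := by
      rw [← hZ]
      ext i j
      rw [Matrix.sub_apply, Matrix.mul_apply, Matrix.mul_apply, Matrix.mul_apply,
        Fintype.sum_sum_type]
      simp [signatureMatrix, Matrix.mul_diagonal, inertiaSign]
    rw [h1]
    exact Matrix.posSemidef_conjTranspose_mul_self _
  have hmain := sum_mul_le_sum_mul_norm_sq hk _ hP w (fun a => l (Sum.inl a) - l₀) hw hw0
    (fun a b hab => sub_le_sub_right (hmono hab) _) (fun a => sub_nonneg.mpr (hpos a))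
  have hdiag : ∀ j, ∑ a, (l (Sum.inl a) - l₀) * ‖Z (Sum.inl a) j‖ ^ 2 + l₀ ≤
      (((W * Z)ᴴ * S * (W * Z)) j j).re := by
    intro j
    rw [conjTranspose_mul_mul_of_frame hWJ hSW, re_conjTranspose_mul_diagonal_mul_apply,
      Fintype.sum_sum_type]
    have h1 : ∑ b, l (Sum.inr b) * ‖Z (Sum.inr b) j‖ ^ 2 ≤ l₀ * ∑ b, ‖Z (Sum.inr b) j‖ ^ 2 := by
      rw [Finset.mul_sum]
      exact Finset.sum_le_sum fun b _ => mul_le_mul_of_nonneg_right (hneg b) (by positivity)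
    have h2 := hnorm j
    simp only [inertiaSign, Sum.elim_inl, Sum.elim_inr, sub_mul, Finset.sum_sub_distrib,
      ← Finset.mul_sum, one_mul, neg_mul, Finset.sum_neg_distrib]
    have h3 : ∑ a, ‖Z (Sum.inl a) j‖ ^ 2 = 1 + ∑ b, ‖Z (Sum.inr b) j‖ ^ 2 := by linarith
    rw [h3]
    linarith
  have h4 : ∑ j, w j * (∑ a, (l (Sum.inl a) - l₀) * ‖Z (Sum.inl a) j‖ ^ 2 + l₀) ≤
      ∑ j, w j * (((W * Z)ᴴ * S * (W * Z)) j j).re :=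
    Finset.sum_le_sum fun j _ => mul_le_mul_of_nonneg_left (hdiag j) (hw0 j)
  refine le_trans ?_ h4
  simp only [mul_add, Finset.sum_add_distrib]
  simp only [mul_sub, Finset.sum_sub_distrib, Matrix.submatrix_apply, id] at hmain
  simp only [sub_mul] at hmain ⊢
  linarith

theorem exists_weighted_sum_eq_of_frame {k : ℕ} (hk : k ≤ p)
    (hWJ : Wᴴ * signatureMatrix p q * W = signatureMatrix p q)
    (hSW : S * W = signatureMatrix p q * W * Matrix.diagonal (fun x => (l x : ℂ))) :
    ∃ Y : Matrix (Fin p ⊕ Fin q) (Fin k) ℂ, Yᴴ * signatureMatrix p q * Y = 1 ∧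
      ∀ j, ((Yᴴ * S * Y) j j).re = l (Sum.inl (Fin.castLE hk j)) := by
  let Z : Matrix (Fin p ⊕ Fin q) (Fin k) ℂ :=
    Matrix.of fun x j => if x = Sum.inl (Fin.castLE hk j) then 1 else 0
  have hZ : ∀ d : Fin p ⊕ Fin q → ℂ, Zᴴ * Matrix.diagonal d * Z =
      Matrix.diagonal fun j => d (Sum.inl (Fin.castLE hk j)) := by
    intro d
    ext i j
    rw [Matrix.mul_apply, Finset.sum_eq_single (Sum.inl (Fin.castLE hk j))]
    · rcases eq_or_ne i j with rfl | hij
      · simp [Z, Matrix.mul_diagonal]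
      · simp [Z, Matrix.mul_diagonal, hij, hij.symm]
    · intro b _ hb
      simp [Z, hb]
    · simp
  refine ⟨W * Z, ?_, fun j => ?_⟩
  · calc _ = Zᴴ * (Wᴴ * signatureMatrix p q * W) * Z := by
          rw [Matrix.conjTranspose_mul]; simp only [Matrix.mul_assoc]
      _ = 1 := by rw [hWJ, signatureMatrix, hZ]; simp [inertiaSign]
  · rw [conjTranspose_mul_mul_of_frame hWJ hSW, hZ]
    simp [inertiaSign]

end frame

/-! ### Semidefinite pencils with a signature matrix -/

open Filter Topology in
/-- The passage from definite to semidefinite pencils: replace `S` by `S + ε` with `ε → 0`. The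
eigenvalues of the perturbed pencils are bounded, so they converge along a subsequence. The limits
are the roots of `det (S - λ J)`; the lower bound passes to the limit, and minimizers of the
perturbed problems are near-minimizers of the original one. No minimizer needs to exist in the
limit, where `S - λ J` may fail to be diagonalizable. -/
theorem exists_eigenvalues_of_posSemidef {p q : ℕ}
    {S : Matrix (Fin p ⊕ Fin q) (Fin p ⊕ Fin q) ℂ} {l₀ : ℝ}
    (hS : (S - (l₀ : ℂ) • signatureMatrix p q).PosSemidef) :
    ∃ l : Fin p ⊕ Fin q → ℝ, Monotone (l ∘ Sum.inl) ∧ (∀ i, l₀ ≤ l (Sum.inl i)) ∧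
      (∀ i, l (Sum.inr i) ≤ l₀) ∧
      (∀ z : ℂ, (S - z • signatureMatrix p q).det =
        (signatureMatrix p q).det * ∏ x, ((l x : ℂ) - z)) ∧
      ∀ {k : ℕ} (hk : k ≤ p) (w : Fin k → ℝ), Antitone w → (∀ j, 0 ≤ w j) →
        (∀ Y : Matrix (Fin p ⊕ Fin q) (Fin k) ℂ, Yᴴ * signatureMatrix p q * Y = 1 →
          ∑ j, w j * l (Sum.inl (Fin.castLE hk j)) ≤ ∑ j, w j * ((Yᴴ * S * Y) j j).re) ∧
        ∀ δ > 0, ∃ Y : Matrix (Fin p ⊕ Fin q) (Fin k) ℂ, Yᴴ * signatureMatrix p q * Y = 1 ∧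
          ∑ j, w j * ((Yᴴ * S * Y) j j).re < ∑ j, w j * l (Sum.inl (Fin.castLE hk j)) + δ := by
  let ε : ℕ → ℝ := fun m => 1 / ((m : ℝ) + 1)
  have hε : ∀ m, 0 < ε m := fun m => Nat.one_div_pos_of_nat
  have hε1 : ∀ m, ε m ≤ 1 := fun m => by
    simpa [ε] using (inv_le_one_of_one_le₀ (by linarith [(Nat.cast_nonneg m : (0 : ℝ) ≤ m)] :
      (1 : ℝ) ≤ (m : ℝ) + 1))
  have hε0 : Tendsto ε atTop (𝓝 0) := tendsto_one_div_add_atTop_nhds_zero_nat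
  let P : ℕ → Matrix (Fin p ⊕ Fin q) (Fin p ⊕ Fin q) ℂ := fun m => S + (ε m : ℂ) • 1
  have hP : ∀ m, (P m - (l₀ : ℂ) • signatureMatrix p q).PosDef := by
    intro m
    have h1 : P m - (l₀ : ℂ) • signatureMatrix p q =
        (S - (l₀ : ℂ) • signatureMatrix p q) + (ε m : ℂ) • 1 := by
      simp only [P]
      abel
    rw [h1]
    exact Matrix.PosDef.posSemidef_add hS
      (Matrix.PosDef.one.smul (by exact_mod_cast hε m))
  choose W l hW hWJ hSW hmono hpos hneg using fun m => exists_frame_of_posDef (hP m)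
  -- a bound for the eigenvalues of all perturbed pencils, as `ε m ≤ 1`
  let R : ℝ := ∑ i, ∑ j, (‖S i j‖ + ‖(1 : Matrix (Fin p ⊕ Fin q) (Fin p ⊕ Fin q) ℂ) i j‖)
  have hbound : ∀ m, l m ∈ Metric.closedBall (0 : Fin p ⊕ Fin q → ℝ) R := by
    intro m
    have hR : 0 ≤ R := Finset.sum_nonneg fun i _ => Finset.sum_nonneg fun j _ => by positivity
    rw [mem_closedBall_zero_iff, pi_norm_le_iff_of_nonneg hR]
    intro x
    refine (abs_le_sum_norm_of_frame (hW m) (hSW m) x).trans ?_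
    refine Finset.sum_le_sum fun i _ => Finset.sum_le_sum fun j _ => ?_
    refine (norm_add_le _ _).trans (add_le_add le_rfl ?_)
    rw [Matrix.smul_apply, norm_smul, Complex.norm_real, Real.norm_eq_abs, abs_of_pos (hε m)]
    exact mul_le_of_le_one_left (norm_nonneg _) (hε1 m)
  obtain ⟨μ, -, φ, hφ, hlim⟩ := tendsto_subseq_of_bounded Metric.isBounded_closedBall hbound
  have hlimx : ∀ x, Tendsto (fun m => l (φ m) x) atTop (𝓝 (μ x)) := fun x =>
    (tendsto_pi_nhds.mp hlim) x
  have hεφ : Tendsto (fun m => ε (φ m)) atTop (𝓝 0) := hε0.comp hφ.tendsto_atTop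
  have hεφ' : Tendsto (fun m => (ε (φ m) : ℂ)) atTop (𝓝 0) := by
    simpa [Function.comp_def] using (Complex.continuous_ofReal.tendsto 0).comp hεφ
  have hquad : ∀ {k : ℕ} (w : Fin k → ℝ) (Y : Matrix (Fin p ⊕ Fin q) (Fin k) ℂ) (m : ℕ),
      ∑ j, w j * ((Yᴴ * P m * Y) j j).re =
        ∑ j, w j * ((Yᴴ * S * Y) j j).re + ε m * ∑ j, w j * ((Yᴴ * Y) j j).re := by
    intro k w Y m
    rw [Finset.mul_sum, ← Finset.sum_add_distrib]
    refine Finset.sum_congr rfl fun j _ => ?_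
    have : Yᴴ * P m * Y = Yᴴ * S * Y + (ε m : ℂ) • (Yᴴ * Y) := by
      simp [P, Matrix.mul_add, Matrix.add_mul]
    rw [this, Matrix.add_apply, Matrix.smul_apply, Complex.add_re, smul_eq_mul,
      Complex.re_ofReal_mul]
    ring
  refine ⟨μ, fun a b hab => ?_, fun i => ?_, fun i => ?_, fun z => ?_, ?_⟩
  · exact le_of_tendsto_of_tendsto' (hlimx _) (hlimx _) fun m => hmono _ hab
  · exact ge_of_tendsto' (hlimx _) fun m => hpos _ i
  · exact le_of_tendsto' (hlimx _) fun m => hneg _ i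
  · have h1 : Tendsto (fun m => (P (φ m) - z • signatureMatrix p q).det) atTop
        (𝓝 (S - z • signatureMatrix p q).det) := by
      have h2 : Continuous fun t : ℂ => (S + t • 1 - z • signatureMatrix p q).det := by
        fun_prop
      have h3 := (h2.tendsto 0).comp hεφ'
      simpa [Function.comp_def, P] using h3
    have h2 : Tendsto (fun m => (signatureMatrix p q).det * ∏ x, ((l (φ m) x : ℂ) - z)) atTop
        (𝓝 ((signatureMatrix p q).det * ∏ x, ((μ x : ℂ) - z))) :=
      (tendsto_finsetProd _ fun x _ =>
        (((Complex.continuous_ofReal.tendsto _).comp (hlimx x)).sub_const z)).const_mul _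
    refine tendsto_nhds_unique h1 (h2.congr fun m => ?_)
    exact (det_sub_smul_of_frame (hW _) (hSW _) z).symm
  · intro k hk w hw hw0
    have hsum : Tendsto (fun m => ∑ j, w j * l (φ m) (Sum.inl (Fin.castLE hk j))) atTop
        (𝓝 (∑ j, w j * μ (Sum.inl (Fin.castLE hk j)))) :=
      tendsto_finsetSum _ fun j _ => (hlimx _).const_mul _
    refine ⟨fun Y hY => ?_, fun δ hδ => ?_⟩
    · have h1 : Tendsto (fun m => ∑ j, w j * ((Yᴴ * P (φ m) * Y) j j).re) atTop
          (𝓝 (∑ j, w j * ((Yᴴ * S * Y) j j).re)) := by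
        simp only [hquad]
        simpa using (hεφ.mul_const (∑ j, w j * ((Yᴴ * Y) j j).re)).const_add
          (∑ j, w j * ((Yᴴ * S * Y) j j).re)
      exact le_of_tendsto_of_tendsto' hsum h1 fun m =>
        weighted_sum_le_of_frame hk (hW _) (hWJ _) (hSW _) (hmono _) (hpos _) (hneg _) hw hw0 hY
    · obtain ⟨m, hm⟩ := (hsum.eventually_lt_const (lt_add_of_pos_right _ hδ)).exists
      obtain ⟨Y, hY, hYS⟩ := exists_weighted_sum_eq_of_frame hk (hWJ (φ m)) (hSW (φ m))
      refine ⟨Y, hY, lt_of_le_of_lt ?_ hm⟩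
      have h1 := hquad w Y (φ m)
      simp only [hYS] at h1
      rw [h1]
      refine le_add_of_nonneg_right (mul_nonneg (hε _).le ?_)
      exact Finset.sum_nonneg fun j _ => mul_nonneg (hw0 j)
        (Complex.le_def.mp (Matrix.posSemidef_conjTranspose_mul_self Y).diag_nonneg).1

/-! ### Splitting off the infinite eigenvalues and the common null space -/

theorem exists_congr_signatureMatrix {n p q : ℕ} {B : Matrix (Fin n) (Fin n) ℂ}
    (hB : B.IsHermitian) (hp : posInertia hB = p) (hq : negInertia hB = q) :
    ∃ (T : Matrix (Fin p ⊕ Fin q) (Fin n) ℂ) (W : Matrix (Fin n) (Fin p ⊕ Fin q) ℂ),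
      T * W = 1 ∧ B = Tᴴ * signatureMatrix p q * T := by
  obtain ⟨T, W, -, -, -, -, hTW, hBT, -⟩ := exists_signed_frame (A := 0) (a := 0) (l₀ := 0)
    (Matrix.UnitaryGroup.det_isUnit hB.eigenvectorUnitary) (by simp)
    (conjTranspose_eigenvectorUnitary_mul_mul hB) (by simp) hp hq
  exact ⟨T, W, hTW, hBT⟩

/-- The columns of `F` span a complement of the kernel of `G` and are orthonormal for the form
`G`. -/
theorem exists_whitening {n : ℕ} {G : Matrix (Fin n) (Fin n) ℂ} (hG : G.PosSemidef) :
    ∃ (m : ℕ) (F : Matrix (Fin n) (Fin m) ℂ), Fᴴ * G * F = 1 ∧ G = G * F * Fᴴ * G := by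
  have hq : negInertia hG.1 = 0 := by
    rw [negInertia, Finset.card_eq_zero, Finset.filter_eq_empty_iff]
    exact fun i _ => not_lt.mpr (hG.eigenvalues_nonneg i)
  obtain ⟨p, hp⟩ : ∃ p, posInertia hG.1 = p := ⟨_, rfl⟩
  obtain ⟨T, W, hTW, hGT⟩ := exists_congr_signatureMatrix hG.1 hp hq
  clear hp hq hG
  have hJ : signatureMatrix p 0 = 1 := by
    rw [signatureMatrix, ← Matrix.diagonal_one]
    congr 1
    ext x
    rcases x with x | x
    · simp [inertiaSign]
    · exact x.elim0
  rw [hJ, Matrix.mul_one] at hGT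
  have hWT : Wᴴ * Tᴴ = 1 := by rw [← Matrix.conjTranspose_mul, hTW, Matrix.conjTranspose_one]
  have h1 : Wᴴ * G * W = 1 := by
    rw [hGT]
    calc _ = (Wᴴ * Tᴴ) * (T * W) := by simp only [Matrix.mul_assoc]
      _ = 1 := by rw [hWT, hTW, Matrix.mul_one]
  have h2 : G * W * Wᴴ * G = G := by
    rw [hGT]
    calc _ = Tᴴ * (T * W) * (Wᴴ * Tᴴ) * T := by simp only [Matrix.mul_assoc]
      _ = _ := by rw [hWT, hTW]; simp
  let e : Fin p ≃ Fin p ⊕ Fin 0 := (Equiv.sumEmpty _ _).symm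
  refine ⟨p, W.submatrix id e, ?_, ?_⟩
  · calc (W.submatrix id e)ᴴ * G * W.submatrix id e = (Wᴴ * G * W).submatrix e e := rfl
      _ = 1 := by rw [h1, Matrix.submatrix_one_equiv]
  · have h3 : W.submatrix id e * (W.submatrix id e)ᴴ = W * Wᴴ := by
      rw [Matrix.conjTranspose_submatrix, Matrix.submatrix_mul_equiv, Matrix.submatrix_id_id]
    rw [Matrix.mul_assoc G, h3, ← Matrix.mul_assoc, h2]

/-- A positive semidefinite pencil is congruent to `(S - λ J) ⊕ 1 ⊕ 0`, where `J` is the signature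
of `B`. The block `1` is a Schur complement: on `ker B` the form `A - l₀ B` is semidefinite, its
kernel there lies in the common null space of `A` and `B`, and a complement (the range of `W'`) is
split off orthogonally. In particular, the infinite eigenvalues have no Jordan blocks and do not
interfere with the finite ones. -/
theorem exists_congr_decomposition {n p q : ℕ} {A B : Matrix (Fin n) (Fin n) ℂ} (hB : B.IsHermitian)
    (hp : posInertia hB = p) (hq : negInertia hB = q) {l₀ : ℝ}
    (hA : (A - (l₀ : ℂ) • B).PosSemidef) :
    ∃ (m : ℕ) (T : Matrix (Fin p ⊕ Fin q) (Fin n) ℂ)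
      (T' : Matrix (Fin m) (Fin n) ℂ)
      (W : Matrix (Fin n) (Fin p ⊕ Fin q) ℂ)
      (W' : Matrix (Fin n) (Fin m) ℂ)
      (S : Matrix (Fin p ⊕ Fin q) (Fin p ⊕ Fin q) ℂ),
      T * W = 1 ∧ T * W' = 0 ∧ T' * W = 0 ∧ T' * W' = 1 ∧
      (S - (l₀ : ℂ) • signatureMatrix p q).PosSemidef ∧
      A = Tᴴ * S * T + T'ᴴ * T' ∧ B = Tᴴ * signatureMatrix p q * T := by
  obtain ⟨T, W, hTW, hBT⟩ := exists_congr_signatureMatrix hB hp hq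
  set C := A - (l₀ : ℂ) • B with hC
  -- the projection onto `ker T`, which is the kernel of `B`
  let Z := 1 - W * T
  have hTZ : T * Z = 0 := by
    rw [Matrix.mul_sub, ← Matrix.mul_assoc, hTW, Matrix.one_mul, Matrix.mul_one, sub_self]
  obtain ⟨m, F, hF, hGF⟩ := exists_whitening (hA.conjTranspose_mul_mul_same Z)
  let W' := Z * F
  let T' := W'ᴴ * C
  have hT'H : T'ᴴ = C * W' := by
    rw [Matrix.conjTranspose_mul, Matrix.conjTranspose_conjTranspose, hA.1.eq]
  have hTW' : T * W' = 0 := by rw [← Matrix.mul_assoc, hTZ, Matrix.zero_mul]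
  have hT'W' : T' * W' = 1 := by
    rw [← hF]
    simp only [T', W', Matrix.conjTranspose_mul, Matrix.mul_assoc]
  -- the Schur complement of `C`, which vanishes on `ker B`
  let C' := C - T'ᴴ * T'
  have hC'psd : C'.PosSemidef := by
    have h1 := hA.conjTranspose_mul_mul_same (1 - W' * T')
    have h2 : (1 - W' * T')ᴴ * C * (1 - W' * T') = C' := by
      rw [Matrix.conjTranspose_sub, Matrix.conjTranspose_one, Matrix.conjTranspose_mul,
        Matrix.sub_mul, Matrix.one_mul]
      have h3 : T'ᴴ * W'ᴴ * C = T'ᴴ * T' := Matrix.mul_assoc _ _ _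
      rw [h3, Matrix.mul_sub, Matrix.mul_one, Matrix.sub_mul (C : Matrix (Fin n) (Fin n) ℂ),
        ← Matrix.mul_assoc C, ← hT'H, ← Matrix.mul_assoc (T'ᴴ * T'), Matrix.mul_assoc T'ᴴ T' W',
        hT'W', Matrix.mul_one, sub_self, sub_zero]
    rwa [h2] at h1
  have hZC'Z : Zᴴ * C' * Z = 0 := by
    have h1 : Zᴴ * (T'ᴴ * T') * Z = Zᴴ * C * Z * F * Fᴴ * (Zᴴ * C * Z) := by
      rw [hT'H]
      simp only [T', W', Matrix.conjTranspose_mul, Matrix.mul_assoc]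
    have h2 : Zᴴ * C' * Z = Zᴴ * C * Z - Zᴴ * (T'ᴴ * T') * Z := by
      rw [← Matrix.sub_mul, ← Matrix.mul_sub]
    rw [h2, h1, ← hGF, sub_self]
  have hC'Z : C' * Z = 0 := by
    obtain ⟨r, E, -, hE⟩ := exists_whitening hC'psd
    have h1 : (Eᴴ * C' * Z)ᴴ * (Eᴴ * C' * Z) = 0 := by
      rw [Matrix.conjTranspose_mul, Matrix.conjTranspose_mul, hC'psd.1.eq,
        Matrix.conjTranspose_conjTranspose, ← hZC'Z]
      nth_rewrite 3 [hE]
      simp only [Matrix.mul_assoc]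
    rw [Matrix.conjTranspose_mul_self_eq_zero] at h1
    rw [hE, Matrix.mul_assoc, Matrix.mul_assoc, ← Matrix.mul_assoc Eᴴ, h1, Matrix.mul_zero]
  have hZC' : Zᴴ * C' = 0 := by
    have h1 := congrArg Matrix.conjTranspose hC'Z
    rwa [Matrix.conjTranspose_mul, hC'psd.1.eq, Matrix.conjTranspose_zero] at h1
  have hC'T : C' = Tᴴ * (Wᴴ * C' * W) * T := by
    have h1 : C' * (W * T) = C' := by
      have h2 : W * T = 1 - Z := by simp [Z]
      rw [h2, Matrix.mul_sub, Matrix.mul_one, hC'Z, sub_zero]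
    have h3 : (W * T)ᴴ * C' = C' := by
      have h2 : W * T = 1 - Z := by simp [Z]
      rw [h2, Matrix.conjTranspose_sub, Matrix.conjTranspose_one, Matrix.sub_mul, Matrix.one_mul,
        hZC', sub_zero]
    calc C' = (W * T)ᴴ * (C' * (W * T)) := by rw [h1, h3]
      _ = _ := by rw [Matrix.conjTranspose_mul]; simp only [Matrix.mul_assoc]
  -- `W` is corrected so that its range is also annihilated by `T'`
  refine ⟨m, T, T', W - W' * T' * W, W', Wᴴ * C' * W + (l₀ : ℂ) • signatureMatrix p q, ?_, hTW', ?_,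
    hT'W', ?_, ?_, hBT⟩
  · rw [Matrix.mul_sub, hTW, ← Matrix.mul_assoc, ← Matrix.mul_assoc, hTW', Matrix.zero_mul,
      Matrix.zero_mul, sub_zero]
  · rw [Matrix.mul_sub, ← Matrix.mul_assoc, ← Matrix.mul_assoc, hT'W', Matrix.one_mul, sub_self]
  · rw [add_sub_cancel_right]
    exact hC'psd.conjTranspose_mul_mul_same W
  · rw [Matrix.mul_add, Matrix.add_mul, ← hC'T, Matrix.mul_smul, Matrix.smul_mul, ← hBT]
    simp only [C', hC]
    abel

/-! ### The objective and the finite eigenvalues in reduced coordinates -/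

theorem trace_mul_eq_sum_of_unitary {k : ℕ} {D Q : Matrix (Fin k) (Fin k) ℂ} {ω : Fin k → ℝ}
    (hQ : Q ∈ Matrix.unitaryGroup (Fin k) ℂ)
    (hQD : Qᴴ * D * Q = Matrix.diagonal (fun i => (ω i : ℂ))) (R : Matrix (Fin k) (Fin k) ℂ) :
    (D * R).trace.re = ∑ j, ω j * ((Qᴴ * R * Q) j j).re := by
  have hQQ : Q * Qᴴ = 1 := Matrix.mem_unitaryGroup_iff.mp hQ
  have h1 : (D * R).trace = (Qᴴ * D * Q * (Qᴴ * R * Q)).trace := by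
    calc (D * R).trace = (D * (Q * Qᴴ) * R * (Q * Qᴴ)).trace := by simp [hQQ]
      _ = ((D * Q * Qᴴ * R * Q) * Qᴴ).trace := by simp only [Matrix.mul_assoc]
      _ = _ := by rw [Matrix.trace_mul_comm]; simp only [Matrix.mul_assoc]
  rw [h1, hQD, Matrix.trace, Complex.re_sum]
  refine Finset.sum_congr rfl fun j _ => ?_
  rw [Matrix.diag_apply, Matrix.diagonal_mul, Complex.re_ofReal_mul]

/-- In terms of the columns of `X Q`, the objective is a weighted sum of values of the form `A`. -/
theorem trace_eq_weighted_sum {n k : ℕ} {A : Matrix (Fin n) (Fin n) ℂ}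
    {D Q : Matrix (Fin k) (Fin k) ℂ} {ω : Fin k → ℝ}
    (hQ : Q ∈ Matrix.unitaryGroup (Fin k) ℂ)
    (hQD : Qᴴ * D * Q = Matrix.diagonal (fun i => (ω i : ℂ))) (X : Matrix (Fin n) (Fin k) ℂ) :
    (D * (Xᴴ * A * X)).trace.re = ∑ j, ω j * (((X * Q)ᴴ * A * (X * Q)) j j).re := by
  rw [trace_mul_eq_sum_of_unitary hQ hQD, Matrix.conjTranspose_mul]
  simp only [Matrix.mul_assoc]

theorem conjTranspose_mul_mul_unitary_eq_one_iff {n k : ℕ} {B : Matrix (Fin n) (Fin n) ℂ}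
    {Q : Matrix (Fin k) (Fin k) ℂ} (hQ : Q ∈ Matrix.unitaryGroup (Fin k) ℂ)
    (X : Matrix (Fin n) (Fin k) ℂ) :
    (X * Q)ᴴ * B * (X * Q) = 1 ↔ Xᴴ * B * X = 1 := by
  have hQQ : Q * Qᴴ = 1 := Matrix.mem_unitaryGroup_iff.mp hQ
  have hQQ' : Qᴴ * Q = 1 := Matrix.mem_unitaryGroup_iff'.mp hQ
  have h1 : (X * Q)ᴴ * B * (X * Q) = Qᴴ * (Xᴴ * B * X) * Q := by
    rw [Matrix.conjTranspose_mul]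
    simp only [Matrix.mul_assoc]
  rw [h1]
  constructor
  · intro h
    calc Xᴴ * B * X = (Q * Qᴴ) * (Xᴴ * B * X) * (Q * Qᴴ) := by simp [hQQ]
      _ = Q * (Qᴴ * (Xᴴ * B * X) * Q) * Qᴴ := by simp only [Matrix.mul_assoc]
      _ = 1 := by rw [h, Matrix.mul_one, hQQ]
  · intro h
    rw [h, Matrix.mul_one, hQQ']

theorem posSemidef_iff_of_unitary_diagonal {k : ℕ} {D Q : Matrix (Fin k) (Fin k) ℂ} {ω : Fin k → ℝ}
    (hQ : Q ∈ Matrix.unitaryGroup (Fin k) ℂ)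
    (hQD : Qᴴ * D * Q = Matrix.diagonal (fun i => (ω i : ℂ))) :
    D.PosSemidef ↔ ∀ j, 0 ≤ ω j := by
  have hU : IsUnit Q := IsUnit.of_mul_eq_one _ (Matrix.mem_unitaryGroup_iff.mp hQ)
  rw [← Matrix.IsUnit.posSemidef_star_left_conjugate_iff hU, Matrix.star_eq_conjTranspose, hQD,
    Matrix.posSemidef_diagonal_iff]
  simp

theorem posTypeEigenvalue_eq {n p q : ℕ} {A B : Matrix (Fin n) (Fin n) ℂ} (hB : B.IsHermitian)
    (hq : negInertia hB = q) {l₀ : ℝ} {l : Fin p ⊕ Fin q → ℝ}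
    (hfin : finiteEigenvalues A B = Finset.univ.val.map fun x => (l x : ℂ))
    (hmono : Monotone (l ∘ Sum.inl)) (hpos : ∀ i, l₀ ≤ l (Sum.inl i))
    (hneg : ∀ i, l (Sum.inr i) ≤ l₀) (i : Fin p) :
    posTypeEigenvalue A hB i = l (Sum.inl i) := by
  rw [posTypeEigenvalue, hq]
  refine getD_sort_eq _ l l₀ ?_ hmono hpos hneg i
  rw [hfin, Multiset.map_map]
  simp

open Polynomial in
theorem finiteEigenvalues_of_decomposition {n p q m : ℕ} {A B : Matrix (Fin n) (Fin n) ℂ}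
    {T : Matrix (Fin p ⊕ Fin q) (Fin n) ℂ} {T' : Matrix (Fin m) (Fin n) ℂ}
    {W : Matrix (Fin n) (Fin p ⊕ Fin q) ℂ} {W' : Matrix (Fin n) (Fin m) ℂ}
    {S : Matrix (Fin p ⊕ Fin q) (Fin p ⊕ Fin q) ℂ} {l : Fin p ⊕ Fin q → ℝ}
    (hTW : T * W = 1) (hTW' : T * W' = 0) (hT'W : T' * W = 0) (hT'W' : T' * W' = 1)
    (hA : A = Tᴴ * S * T + T'ᴴ * T') (hB : B = Tᴴ * signatureMatrix p q * T)
    (hdet : ∀ z : ℂ, (S - z • signatureMatrix p q).det =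
        (signatureMatrix p q).det * ∏ x, ((l x : ℂ) - z)) :
    finiteEigenvalues A B = Finset.univ.val.map fun x => (l x : ℂ) := by
  have hJ : (signatureMatrix p q).det ≠ 0 := by
    have h := congrArg Matrix.det (signatureMatrix_mul_self p q)
    rw [Matrix.det_mul, Matrix.det_one] at h
    exact left_ne_zero_of_mul_eq_one h
  let c : ℂ := (signatureMatrix p q).det * ∏ _x : Fin p ⊕ Fin q, (-1)
  have hc : c ≠ 0 := mul_ne_zero hJ (Finset.prod_ne_zero_iff.mpr fun _ _ => by norm_num)
  have hprod : ∏ x : Fin p ⊕ Fin q, (X - C (l x : ℂ)) ≠ 0 :=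
    Finset.prod_ne_zero_iff.mpr fun x _ => X_sub_C_ne_zero _
  rw [finiteEigenvalues_eq_roots (Matrix.fromRows T T') (Matrix.fromCols W W')
    (Matrix.fromBlocks S 0 0 1) (Matrix.fromBlocks (signatureMatrix p q) 0 0 0) ?_ ?_ ?_
    (C c * ∏ x, (X - C (l x : ℂ))) ?_ ?_]
  · rw [roots_C_mul _ hc]
    have h := roots_multiset_prod_X_sub_C (Finset.univ.val.map fun x : Fin p ⊕ Fin q => (l x : ℂ))
    rwa [Multiset.map_map] at h
  · rw [Matrix.fromRows_mul_fromCols, hTW, hTW', hT'W, hT'W', Matrix.fromBlocks_one]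
  · rw [hA, Matrix.conjTranspose_fromRows_eq_fromCols_conjTranspose,
      Matrix.fromCols_mul_fromBlocks, Matrix.fromCols_mul_fromRows]
    simp
  · rw [hB, Matrix.conjTranspose_fromRows_eq_fromCols_conjTranspose,
      Matrix.fromCols_mul_fromBlocks, Matrix.fromCols_mul_fromRows]
    simp
  · intro z
    have h1 : Matrix.fromBlocks S 0 0 (1 : Matrix (Fin m) (Fin m) ℂ) -
        z • Matrix.fromBlocks (signatureMatrix p q) 0 0 0 =
        Matrix.fromBlocks (S - z • signatureMatrix p q) 0 0 1 := by
      ext (i | i) (j | j) <;> simp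
    rw [h1, Matrix.det_fromBlocks_zero₂₁, Matrix.det_one, mul_one, hdet, eval_mul, eval_C,
      eval_prod, mul_assoc, ← Finset.prod_mul_distrib]
    simp
  · exact mul_ne_zero (C_ne_zero.mpr hc) hprod

open Polynomial in
/-- For a diagonalized pencil, the indices with `b ≠ 0` yield the finite eigenvalues `a / b`. Those
with `b = 0 ≠ a` contribute constant factors to the determinant, and those with `a = b = 0` are
dropped. -/
theorem finiteEigenvalues_of_diagonal {n p q : ℕ} {A B U : Matrix (Fin n) (Fin n) ℂ}
    {a b : Fin n → ℝ} (hU : IsUnit U.det)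
    (hA : Uᴴ * A * U = Matrix.diagonal fun y => (a y : ℂ))
    (hB : Uᴴ * B * U = Matrix.diagonal fun y => (b y : ℂ)) {e : Fin p ⊕ Fin q → Fin n}
    (he : Function.Injective e) (hran : ∀ y, b y ≠ 0 ↔ y ∈ Set.range e) :
    finiteEigenvalues A B = Finset.univ.val.map fun x => ((a (e x) / b (e x) : ℝ) : ℂ) := by
  classical
  let σ := {y // ¬ (a y = 0 ∧ b y = 0)}
  have hUU : U * U⁻¹ = 1 := Matrix.mul_nonsing_inv U hU
  have hUU' : U⁻¹ * U = 1 := Matrix.nonsing_inv_mul U hU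
  have hUH : (U⁻¹)ᴴ * Uᴴ = 1 := by
    rw [← Matrix.conjTranspose_mul, hUU, Matrix.conjTranspose_one]
  have hM : ∀ {M : Matrix (Fin n) (Fin n) ℂ} {d : Fin n → ℝ},
      Uᴴ * M * U = Matrix.diagonal (fun y => (d y : ℂ)) → (∀ y, a y = 0 ∧ b y = 0 → d y = 0) →
      M = (U⁻¹.submatrix (Subtype.val : σ → Fin n) id)ᴴ *
        Matrix.diagonal (fun y : σ => (d y : ℂ)) *
        U⁻¹.submatrix (Subtype.val : σ → Fin n) id := by
    intro M d h hd
    have h1 : M = (U⁻¹)ᴴ * Matrix.diagonal (fun y => (d y : ℂ)) * U⁻¹ := by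
      rw [← h]
      calc M = ((U⁻¹)ᴴ * Uᴴ) * M * (U * U⁻¹) := by rw [hUH, hUU]; simp
        _ = _ := by simp only [Matrix.mul_assoc]
    rw [h1]
    ext i j
    rw [Matrix.mul_apply, Matrix.mul_apply]
    symm
    refine Fintype.sum_of_injective _ Subtype.val_injective _ _ (fun y hy => ?_) fun x => ?_
    · have : d y = 0 := hd y (by
        by_contra h
        exact hy ⟨⟨y, h⟩, rfl⟩)
      simp [this]
    · simp [Matrix.mul_diagonal]
  let c : ℂ := ∏ _y : σ, (-1)
  have hc : c ≠ 0 := Finset.prod_ne_zero_iff.mpr fun _ _ => by norm_num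
  have hfac : ∀ y : σ, C (b y : ℂ) * X - C (a y : ℂ) ≠ 0 := by
    intro y h0
    have h1 := congrArg (fun f => f.coeff 0) h0
    have h2 := congrArg (fun f => f.coeff 1) h0
    simp [coeff_C] at h1 h2
    exact y.2 ⟨h1, h2⟩
  have hprod : ∏ y : σ, (C (b y : ℂ) * X - C (a y : ℂ)) ≠ 0 :=
    Finset.prod_ne_zero_iff.mpr fun y _ => hfac y
  rw [finiteEigenvalues_eq_roots (U⁻¹.submatrix (Subtype.val : σ → Fin n) id)
    (U.submatrix id (Subtype.val : σ → Fin n)) (Matrix.diagonal fun y : σ => (a y : ℂ))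
    (Matrix.diagonal fun y : σ => (b y : ℂ)) ?_ (hM hA fun y h => h.1) (hM hB fun y h => h.2)
    (C c * ∏ y : σ, (C (b y : ℂ) * X - C (a y : ℂ))) ?_ ?_]
  · rw [roots_C_mul _ hc, roots_prod _ _ hprod]
    have h1 : (Finset.univ.val.bind fun y : σ => (C (b y : ℂ) * X - C (a y : ℂ)).roots) =
        ∑ y : σ, (C (b y : ℂ) * X - C (a y : ℂ)).roots := rfl
    have h2 : (Finset.univ.val.map fun x => ((a (e x) / b (e x) : ℝ) : ℂ)) =
        ∑ x, {((a (e x) / b (e x) : ℝ) : ℂ)} :=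
      (Multiset.sum_map_singleton _).symm.trans (by rw [Multiset.map_map]; rfl)
    rw [h1, h2]
    symm
    have hb : ∀ x, b (e x) ≠ 0 := fun x => (hran _).mpr ⟨x, rfl⟩
    refine Fintype.sum_of_injective (fun x => (⟨e x, fun h => hb x h.2⟩ : σ))
      (fun x y h => he (congrArg Subtype.val h)) _ _ (fun y hy => ?_) fun x => ?_
    · have : b y = 0 := by
        by_contra h
        obtain ⟨x, hx⟩ := (hran y).mp h
        exact hy ⟨x, Subtype.ext hx⟩
      rw [this, Complex.ofReal_zero, C_0, zero_mul, zero_sub, roots_neg, roots_C]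
    · rw [roots_C_mul_X_sub_C _ (Complex.ofReal_ne_zero.mpr (hb x)), Complex.ofReal_div,
        div_eq_inv_mul]
  · rw [← Matrix.submatrix_mul _ _ _ id _ Function.bijective_id, hUU',
      Matrix.submatrix_one _ Subtype.val_injective]
  · intro z
    rw [← Matrix.diagonal_smul, Matrix.diagonal_sub, Matrix.det_diagonal, eval_mul, eval_C,
      eval_prod, ← Finset.prod_mul_distrib]
    refine Finset.prod_congr rfl fun y _ => ?_
    simp
    ring
  · exact mul_ne_zero (C_ne_zero.mpr hc) hprod

/-! ### Unboundedness for indefinite weights -/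

/-- A hyperbolic rotation in the plane of a positive and a negative coordinate keeps the vectors
`J`-orthonormal, and makes one of the values of the form `S` as large as desired while the others
stay fixed. -/
theorem exists_large_hyperbolic_frame {p q k : ℕ} (hk : k ≤ p)
    {S : Matrix (Fin p ⊕ Fin q) (Fin p ⊕ Fin q) ℂ} (hS : S.PosSemidef) (hS0 : S ≠ 0) (hq : 0 < q)
    (j₀ : Fin k) :
    ∃ c : Fin k → ℝ, ∀ t : ℝ, ∃ Z : Matrix (Fin p ⊕ Fin q) (Fin k) ℂ,
      Zᴴ * signatureMatrix p q * Z = 1 ∧ (∀ j ≠ j₀, ((Zᴴ * S * Z) j j).re = c j) ∧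
      t ≤ ((Zᴴ * S * Z) j₀ j₀).re := by
  have hdiag : ∀ x, 0 ≤ (S x x).re := fun x => (Complex.le_def.mp hS.diag_nonneg).1
  obtain ⟨a, b, hab⟩ : ∃ a b,
      0 < (S (Sum.inl a) (Sum.inl a)).re + (S (Sum.inr b) (Sum.inr b)).re := by
    by_contra! h
    refine hS0 (hS.trace_eq_zero_iff.mp (Finset.sum_eq_zero fun x _ => ?_))
    have him : (S x x).im = 0 := (Complex.le_def.mp (hS.diag_nonneg (i := x))).2.symm
    refine Complex.ext (show (S x x).re = 0 from ?_) him
    rcases x with a | b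
    · exact le_antisymm (by linarith [h a ⟨0, hq⟩, hdiag (Sum.inr ⟨0, hq⟩)]) (hdiag _)
    · have a : Fin p := Fin.castLE hk j₀
      exact le_antisymm (by linarith [h a b, hdiag (Sum.inl a)]) (hdiag _)
  let f : Fin k → Fin p := fun j => Equiv.swap (Fin.castLE hk j₀) a (Fin.castLE hk j)
  have hf : Function.Injective f := (Equiv.injective _).comp (Fin.castLE_injective hk)
  have hfj : f j₀ = a := Equiv.swap_apply_left _ _
  refine ⟨fun j => (S (Sum.inl (f j)) (Sum.inl (f j))).re, fun t => ?_⟩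
  set g := (S (Sum.inl a) (Sum.inl a)).re + (S (Sum.inr b) (Sum.inr b)).re with hg
  set h := (S (Sum.inl a) (Sum.inr b)).re with hh
  -- the sign of the `sinh` component makes the cross term nonnegative
  obtain ⟨s, hs, hsh⟩ : ∃ s : ℝ, s ^ 2 = |t| / g ∧ 0 ≤ s * h := by
    have h1 : √(|t| / g) ^ 2 = |t| / g := Real.sq_sqrt (by positivity)
    rcases le_total 0 h with h0 | h0
    · exact ⟨_, h1, mul_nonneg (Real.sqrt_nonneg _) h0⟩
    · exact ⟨-√(|t| / g), by rw [neg_sq, h1], mul_nonneg_of_nonpos_of_nonpos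
        (neg_nonpos.mpr (Real.sqrt_nonneg _)) h0⟩
  set r := √(1 + s ^ 2) with hr
  have hr2 : r ^ 2 = 1 + s ^ 2 := Real.sq_sqrt (by positivity)
  have hr0 : 0 ≤ r := Real.sqrt_nonneg _
  let Z : Matrix (Fin p ⊕ Fin q) (Fin k) ℂ := Matrix.of fun x j =>
    Sum.elim (Pi.single (f j) (if j = j₀ then (r : ℂ) else 1))
      (Pi.single b (if j = j₀ then (s : ℂ) else 0)) x
  refine ⟨Z, ?_, fun j hj => ?_, ?_⟩
  · ext i j
    rw [Matrix.mul_apply, Fintype.sum_sum_type]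
    simp [Z, signatureMatrix, Matrix.mul_diagonal, inertiaSign, Pi.single_apply, Matrix.one_apply]
    have hrs : (r : ℂ) ^ 2 = 1 + (s : ℂ) ^ 2 := by exact_mod_cast hr2
    rcases eq_or_ne i j with rfl | hij
    · by_cases hi : i = j₀
      · simp [hi]
        linear_combination hrs
      · simp [hi]
    · have hfij : f j ≠ f i := fun h => hij (hf h).symm
      by_cases hj : j = j₀
      · have hi : i ≠ j₀ := fun h => hij (h.trans hj.symm)
        simp [hij, hfij, hi]
      · simp [hij, hfij, hj]
  · rw [Matrix.mul_apply]
    simp [Z, Matrix.mul_apply, hj, Pi.single_apply]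
  · have hZ : (Zᴴ * S * Z) j₀ j₀ = r * S (Sum.inl a) (Sum.inl a) * r +
        r * S (Sum.inl a) (Sum.inr b) * s + s * S (Sum.inr b) (Sum.inl a) * r +
        s * S (Sum.inr b) (Sum.inr b) * s := by
      rw [Matrix.mul_apply]
      simp [Z, Matrix.mul_apply, hfj, Pi.single_apply, apply_ite]
      ring
    have hsym : (S (Sum.inr b) (Sum.inl a)).re = h := by
      rw [← hS.1.apply, Complex.star_def, Complex.conj_re]
    have hgt : |t| = s ^ 2 * g := by rw [hs, div_mul_cancel₀ _ hab.ne']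
    have hcross : 0 ≤ r * (s * h) := mul_nonneg hr0 hsh
    rw [hZ]
    simp only [Complex.add_re, Complex.re_mul_ofReal, Complex.re_ofReal_mul, hsym]
    rw [← hh]
    have h1 : t ≤ s ^ 2 * g := hgt ▸ le_abs_self t
    have h2 : r * (S (Sum.inl a) (Sum.inl a)).re * r =
        (1 + s ^ 2) * (S (Sum.inl a) (Sum.inl a)).re := by rw [← hr2]; ring
    rw [h2]
    have h3 := hdiag (Sum.inl a)
    rw [hg] at h1
    linarith

section decomposition

variable {n p q m : ℕ} {A B : Matrix (Fin n) (Fin n) ℂ}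
  {T : Matrix (Fin p ⊕ Fin q) (Fin n) ℂ} {T' : Matrix (Fin m) (Fin n) ℂ}
  {W : Matrix (Fin n) (Fin p ⊕ Fin q) ℂ} {W' : Matrix (Fin n) (Fin m) ℂ}
  {S : Matrix (Fin p ⊕ Fin q) (Fin p ⊕ Fin q) ℂ}

theorem conjTranspose_mul_mul_eq_of_decomposition
    (hA : A = Tᴴ * S * T + T'ᴴ * T') (hB : B = Tᴴ * signatureMatrix p q * T) {k : ℕ}
    (Y : Matrix (Fin n) (Fin k) ℂ) :
    Yᴴ * A * Y = (T * Y)ᴴ * S * (T * Y) + (T' * Y)ᴴ * (T' * Y) ∧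
    Yᴴ * B * Y = (T * Y)ᴴ * signatureMatrix p q * (T * Y) := by
  rw [hA, hB]
  simp only [Matrix.conjTranspose_mul, Matrix.mul_add, Matrix.add_mul, Matrix.mul_assoc, and_self]

theorem conjTranspose_mul_mul_of_decomposition
    (hTW : T * W = 1) (hTW' : T * W' = 0) (hT'W : T' * W = 0) (hT'W' : T' * W' = 1)
    (hA : A = Tᴴ * S * T + T'ᴴ * T') (hB : B = Tᴴ * signatureMatrix p q * T) {k : ℕ}
    (Z : Matrix (Fin p ⊕ Fin q) (Fin k) ℂ) (Z' : Matrix (Fin m) (Fin k) ℂ) :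
    (W * Z + W' * Z')ᴴ * A * (W * Z + W' * Z') = Zᴴ * S * Z + Z'ᴴ * Z' ∧
    (W * Z + W' * Z')ᴴ * B * (W * Z + W' * Z') = Zᴴ * signatureMatrix p q * Z := by
  have h := conjTranspose_mul_mul_eq_of_decomposition hA hB (W * Z + W' * Z')
  have h1 : T * (W * Z + W' * Z') = Z := by
    rw [Matrix.mul_add, ← Matrix.mul_assoc, ← Matrix.mul_assoc, hTW, hTW']
    simp
  have h2 : T' * (W * Z + W' * Z') = Z' := by
    rw [Matrix.mul_add, ← Matrix.mul_assoc, ← Matrix.mul_assoc, hT'W, hT'W']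
    simp
  rwa [h1, h2] at h

/-- If `A ≠ l₀ B`, there are `B`-orthonormal vectors for which the form `A` is arbitrarily large at
one of them and fixed at the others: rotate hyperbolically if `S - l₀ J ≠ 0`, and otherwise add a
multiple of a vector from `ker B` on which `A` is positive. -/
theorem exists_large_frame {l₀ : ℝ}
    (hTW : T * W = 1) (hTW' : T * W' = 0) (hT'W : T' * W = 0) (hT'W' : T' * W' = 1)
    (hS : (S - (l₀ : ℂ) • signatureMatrix p q).PosSemidef)
    (hA : A = Tᴴ * S * T + T'ᴴ * T') (hB : B = Tᴴ * signatureMatrix p q * T)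
    (hAB : A ≠ (l₀ : ℂ) • B) (hq : 0 < q) {k : ℕ} (hk : k ≤ p) (j₀ : Fin k) :
    ∃ c : Fin k → ℝ, ∀ t : ℝ, ∃ Y : Matrix (Fin n) (Fin k) ℂ, Yᴴ * B * Y = 1 ∧
      (∀ j ≠ j₀, ((Yᴴ * A * Y) j j).re = c j) ∧ t ≤ ((Yᴴ * A * Y) j₀ j₀).re := by
  rcases Nat.eq_zero_or_pos m with hm | hm
  · subst hm
    have hT' : T'ᴴ * T' = 0 := by
      ext i j
      simp [Matrix.mul_apply]
    have hS0 : S - (l₀ : ℂ) • signatureMatrix p q ≠ 0 := by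
      intro h
      apply hAB
      rw [hA, hB, hT', sub_eq_zero.mp h]
      simp
    obtain ⟨c, hc⟩ := exists_large_hyperbolic_frame hk hS hS0 hq j₀
    refine ⟨fun j => c j + l₀, fun t => ?_⟩
    obtain ⟨Z, hZJ, hZc, hZt⟩ := hc (t - l₀)
    obtain ⟨hYA, hYB⟩ := conjTranspose_mul_mul_of_decomposition hTW hTW' hT'W hT'W' hA hB Z 0
    have hdiag : ∀ j, ((Zᴴ * S * Z) j j).re =
        ((Zᴴ * (S - (l₀ : ℂ) • signatureMatrix p q) * Z) j j).re + l₀ := by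
      intro j
      rw [Matrix.mul_sub, Matrix.sub_mul, Matrix.mul_smul, Matrix.smul_mul, hZJ]
      simp
    refine ⟨_, hYB.trans hZJ, fun j hj => ?_, ?_⟩
    · rw [hYA, Matrix.mul_zero, add_zero, hdiag, hZc j hj]
    · rw [hYA, Matrix.mul_zero, add_zero, hdiag]
      linarith
  · obtain ⟨Z, hZJ, -⟩ := exists_weighted_sum_eq_of_frame (S := signatureMatrix p q) (W := 1)
      (l := fun _ => 1) hk (by simp) (by simp)
    refine ⟨fun j => ((Zᴴ * S * Z) j j).re, fun t => ?_⟩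
    let r : ℝ := √|t - ((Zᴴ * S * Z) j₀ j₀).re|
    have hr : r * r = |t - ((Zᴴ * S * Z) j₀ j₀).re| := Real.mul_self_sqrt (abs_nonneg _)
    let Z' : Matrix (Fin m) (Fin k) ℂ :=
      Matrix.of fun i j => if i = ⟨0, hm⟩ ∧ j = j₀ then (r : ℂ) else 0
    obtain ⟨hYA, hYB⟩ := conjTranspose_mul_mul_of_decomposition hTW hTW' hT'W hT'W' hA hB Z Z'
    refine ⟨_, hYB.trans hZJ, fun j hj => ?_, ?_⟩
    · have h1 : (Z'ᴴ * Z') j j = 0 := by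
        rw [Matrix.mul_apply]
        simp [Z', hj]
      rw [hYA, Matrix.add_apply, h1, add_zero]
    · have h1 : (Z'ᴴ * Z') j₀ j₀ = (r * r : ℝ) := by
        rw [Matrix.mul_apply]
        simp [Z', apply_ite]
      rw [hYA, Matrix.add_apply, Complex.add_re, h1, Complex.ofReal_re, hr]
      linarith [le_abs_self (t - ((Zᴴ * S * Z) j₀ j₀).re)]

end decomposition

/-- A negative weight `ω j₀` turns large values of the form `A` at the vector `j₀` into arbitrarily
small objective values. -/
theorem not_bot_lt_traceInf {n k : ℕ} {A B : Matrix (Fin n) (Fin n) ℂ}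
    {D Q : Matrix (Fin k) (Fin k) ℂ} {ω : Fin k → ℝ}
    (hQ : Q ∈ Matrix.unitaryGroup (Fin k) ℂ)
    (hQD : Qᴴ * D * Q = Matrix.diagonal (fun i => (ω i : ℂ))) {j₀ : Fin k} (hj₀ : ω j₀ < 0)
    (c : Fin k → ℝ) (hc : ∀ t : ℝ, ∃ Y : Matrix (Fin n) (Fin k) ℂ, Yᴴ * B * Y = 1 ∧
      (∀ j ≠ j₀, ((Yᴴ * A * Y) j j).re = c j) ∧ t ≤ ((Yᴴ * A * Y) j₀ j₀).re) :
    ¬ ⊥ < traceInf A B D := by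
  intro h
  obtain ⟨M, -, hM⟩ := EReal.lt_iff_exists_real_btwn.mp h
  -- with this bound for the value at `j₀`, the objective is at most `M`
  obtain ⟨Y, hYB, hYc, hYt⟩ := hc ((M - ∑ j ∈ Finset.univ.erase j₀, ω j * c j) / ω j₀)
  have hQQ : Qᴴ * Q = 1 := Matrix.mem_unitaryGroup_iff'.mp hQ
  have hY : Y * Qᴴ * Q = Y := by rw [Matrix.mul_assoc, hQQ, Matrix.mul_one]
  have hX : (Y * Qᴴ)ᴴ * B * (Y * Qᴴ) = 1 := by
    rw [← conjTranspose_mul_mul_unitary_eq_one_iff hQ, hY, hYB]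
  refine absurd (hM.trans_le (iInf_le _ ⟨Y * Qᴴ, hX⟩)) (not_lt.mpr ?_)
  rw [EReal.coe_le_coe_iff, trace_eq_weighted_sum hQ hQD, hY,
    ← Finset.add_sum_erase _ _ (Finset.mem_univ j₀),
    Finset.sum_congr rfl fun j hj => by rw [hYc j (Finset.ne_of_mem_erase hj)]]
  rw [div_le_iff_of_neg hj₀] at hYt
  linarith

/-! ### The value of the infimum and its attainment -/

theorem traceInf_eq {n k : ℕ} {A B : Matrix (Fin n) (Fin n) ℂ}
    {D Q : Matrix (Fin k) (Fin k) ℂ} {ω : Fin k → ℝ}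
    (hQ : Q ∈ Matrix.unitaryGroup (Fin k) ℂ)
    (hQD : Qᴴ * D * Q = Matrix.diagonal (fun i => (ω i : ℂ))) {v : ℝ}
    (hle : ∀ Y : Matrix (Fin n) (Fin k) ℂ, Yᴴ * B * Y = 1 →
      v ≤ ∑ j, ω j * ((Yᴴ * A * Y) j j).re)
    (hlt : ∀ δ > 0, ∃ Y : Matrix (Fin n) (Fin k) ℂ, Yᴴ * B * Y = 1 ∧
      ∑ j, ω j * ((Yᴴ * A * Y) j j).re < v + δ) :
    traceInf A B D = (v : EReal) := by
  apply le_antisymm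
  · rw [← EReal.le_of_forall_lt_iff_le]
    intro z hz
    rw [EReal.coe_lt_coe_iff] at hz
    obtain ⟨Y, hYB, hYv⟩ := hlt (z - v) (sub_pos.mpr hz)
    have hQQ : Qᴴ * Q = 1 := Matrix.mem_unitaryGroup_iff'.mp hQ
    have hY : Y * Qᴴ * Q = Y := by rw [Matrix.mul_assoc, hQQ, Matrix.mul_one]
    have hX : (Y * Qᴴ)ᴴ * B * (Y * Qᴴ) = 1 := by
      rw [← conjTranspose_mul_mul_unitary_eq_one_iff hQ, hY, hYB]
    refine (iInf_le _ ⟨Y * Qᴴ, hX⟩).trans ?_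
    rw [EReal.coe_le_coe_iff, trace_eq_weighted_sum hQ hQD, hY]
    linarith
  · refine le_iInf fun X => ?_
    rw [EReal.coe_le_coe_iff, trace_eq_weighted_sum hQ hQD]
    exact hle _ ((conjTranspose_mul_mul_unitary_eq_one_iff hQ X.1).mpr X.2)

theorem conjTranspose_mul_mul_apply_of_isEigenvectorSolution {n k : ℕ}
    {A B : Matrix (Fin n) (Fin n) ℂ} {hB : B.IsHermitian} {Q : Matrix (Fin k) (Fin k) ℂ}
    (hQ : Q ∈ Matrix.unitaryGroup (Fin k) ℂ) {X : Matrix (Fin n) (Fin k) ℂ}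
    (hX : IsEigenvectorSolution A hB Q X) (j : Fin k) :
    (((X * Q)ᴴ * A * (X * Q)) j j).re = posTypeEigenvalue A hB j := by
  have h1 := (conjTranspose_mul_mul_unitary_eq_one_iff hQ X).mpr hX.1
  have h2 : ∀ M : Matrix (Fin n) (Fin n) ℂ, ((X * Q)ᴴ * M * (X * Q)) j j =
      star ((X * Q).col j) ⬝ᵥ M *ᵥ (X * Q).col j := by
    intro M
    rw [Matrix.mul_assoc]
    rfl
  rw [h2, (hX.2 j).2.2.2, dotProduct_smul, ← h2, h1, Matrix.one_apply_eq]
  simp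

theorem exists_isEigenvectorSolution {n k : ℕ} {A B : Matrix (Fin n) (Fin n) ℂ}
    {Q : Matrix (Fin k) (Fin k) ℂ} (hA : A.IsHermitian) (hB : B.IsHermitian) {l₀ : ℝ}
    (hAB : (A - (l₀ : ℂ) • B).PosSemidef) (hk : k ≤ posInertia hB)
    (hQ : Q ∈ Matrix.unitaryGroup (Fin k) ℂ) (hdiag : IsDiagonalizablePencil A B) :
    ∃ X : Matrix (Fin n) (Fin k) ℂ, IsEigenvectorSolution A hB Q X := by
  obtain ⟨p, hp⟩ : ∃ p, posInertia hB = p := ⟨_, rfl⟩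
  obtain ⟨q, hq⟩ : ∃ q, negInertia hB = q := ⟨_, rfl⟩
  rw [hp] at hk
  obtain ⟨U, hU, hUA, hUB⟩ := hdiag
  have hreal : ∀ {M : Matrix (Fin n) (Fin n) ℂ}, M.IsHermitian → (Uᴴ * M * U).IsDiag →
      Uᴴ * M * U = Matrix.diagonal fun y => ((((Uᴴ * M * U) y y).re : ℝ) : ℂ) := by
    intro M hM h
    conv_lhs => rw [← h.diagonal_diag]
    congr 1
    ext y
    exact ((Matrix.isHermitian_conjTranspose_mul_mul U hM).coe_re_apply_self y).symm
  obtain ⟨a, ha⟩ : ∃ a : Fin n → ℝ, Uᴴ * A * U = Matrix.diagonal fun y => (a y : ℂ) :=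
    ⟨_, hreal hA hUA⟩
  obtain ⟨b, hb⟩ : ∃ b : Fin n → ℝ, Uᴴ * B * U = Matrix.diagonal fun y => (b y : ℂ) :=
    ⟨_, hreal hB hUB⟩
  have hab : ∀ y, 0 ≤ a y - l₀ * b y := by
    intro y
    have h1 := (Complex.le_def.mp ((hAB.conjTranspose_mul_mul_same U).diag_nonneg (i := y))).1
    rw [Matrix.mul_sub, Matrix.sub_mul, Matrix.mul_smul, Matrix.smul_mul, ha, hb] at h1
    simpa using h1
  have hUU : U * U⁻¹ = 1 := Matrix.mul_nonsing_inv U hU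
  have hUH : (U⁻¹)ᴴ * Uᴴ = 1 := by
    rw [← Matrix.conjTranspose_mul, hUU, Matrix.conjTranspose_one]
  have hVV' := Matrix.mem_unitaryGroup_iff'.mp hB.eigenvectorUnitary.2
  have hVV := Matrix.mem_unitaryGroup_iff.mp hB.eigenvectorUnitary.2
  rw [Matrix.star_eq_conjTranspose] at hVV hVV'
  have hin := card_pos_eq_and_card_neg_eq_of_congr_eq
    (hB.eigenvectorUnitary.1ᴴ) hB.eigenvectorUnitary.1 hB.eigenvalues U⁻¹ U b hVV'
    (Matrix.nonsing_inv_mul U hU) (by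
      rw [← hb, ← conjTranspose_eigenvectorUnitary_mul_mul hB, Matrix.conjTranspose_conjTranspose]
      calc _ = (hB.eigenvectorUnitary.1 * hB.eigenvectorUnitary.1ᴴ) * B *
            (hB.eigenvectorUnitary.1 * hB.eigenvectorUnitary.1ᴴ) := by
              simp only [Matrix.mul_assoc]
        _ = ((U⁻¹)ᴴ * Uᴴ) * B * (U * U⁻¹) := by rw [hVV, hUH, hUU]
        _ = _ := by simp only [Matrix.mul_assoc])
  obtain ⟨T, W, e, l, he, hran, hTW, hBT, hl, hAW, hmono, hpos, hneg⟩ :=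
    exists_signed_frame hU ha hb hab (hin.1.symm.trans hp) (hin.2.symm.trans hq)
  have hfin : finiteEigenvalues A B = Finset.univ.val.map fun x => (l x : ℂ) := by
    rw [finiteEigenvalues_of_diagonal hU ha hb he hran]
    simp only [hl]
  have htype : ∀ j : Fin k, posTypeEigenvalue A hB j = l (Sum.inl (Fin.castLE hk j)) := fun j =>
    posTypeEigenvalue_eq hB hq hfin hmono hpos hneg (Fin.castLE hk j)
  let Y : Matrix (Fin n) (Fin k) ℂ := W.submatrix id fun j => Sum.inl (Fin.castLE hk j)
  have hQQ : Qᴴ * Q = 1 := Matrix.mem_unitaryGroup_iff'.mp hQ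
  have hY : Y * Qᴴ * Q = Y := by rw [Matrix.mul_assoc, hQQ, Matrix.mul_one]
  have hYB : Yᴴ * B * Y = 1 := by
    have hWT : Wᴴ * Tᴴ = 1 := by rw [← Matrix.conjTranspose_mul, hTW, Matrix.conjTranspose_one]
    have h1 : Wᴴ * B * W = signatureMatrix p q := by
      rw [hBT]
      calc _ = (Wᴴ * Tᴴ) * signatureMatrix p q * (T * W) := by simp only [Matrix.mul_assoc]
        _ = _ := by rw [hWT, hTW]; simp
    calc Yᴴ * B * Y = (Wᴴ * B * W).submatrix (fun j => Sum.inl (Fin.castLE hk j))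
          (fun j => Sum.inl (Fin.castLE hk j)) := rfl
      _ = 1 := by
        ext i j
        simp [h1, signatureMatrix, inertiaSign, Matrix.diagonal_apply, Matrix.one_apply]
  refine ⟨Y * Qᴴ, ?_, fun j => ?_⟩
  · rw [← conjTranspose_mul_mul_unitary_eq_one_iff hQ, hY, hYB]
  · rw [hY, htype]
    have hBne : B *ᵥ Y.col j ≠ 0 := by
      intro h
      have h1 : (Yᴴ * B * Y) j j = star (Y.col j) ⬝ᵥ B *ᵥ Y.col j := by
        rw [Matrix.mul_assoc]
        rfl
      rw [hYB, h, Matrix.one_apply_eq, dotProduct_zero] at h1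
      exact one_ne_zero h1
    refine ⟨?_, fun h => hBne (by rw [h, Matrix.mulVec_zero]), fun h => hBne h.2, ?_⟩
    · rw [← mem_finiteEigenvalues_iff, hfin, Multiset.mem_map]
      exact ⟨_, Finset.mem_univ_val _, rfl⟩
    · ext i
      have h1 := congrFun (congrFun hAW i) (Sum.inl (Fin.castLE hk j))
      rw [Matrix.mul_diagonal, mul_comm] at h1
      exact h1

theorem mainTheorem3 {n k : ℕ} (A B : Matrix (Fin n) (Fin n) ℂ) (D Q : Matrix (Fin k) (Fin k) ℂ)
    (ω : Fin k → ℝ) (hB : B.IsHermitian) (hD : D.IsHermitian)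
    (hpencil : IsPosSemidefPencil A B)
    (hBpos : 0 < posInertia hB) (hBneg : 0 < negInertia hB)
    (hk : k ≤ posInertia hB)
    (hQ : Q ∈ Matrix.unitaryGroup (Fin k) ℂ)
    (hQD : Qᴴ * D * Q = Matrix.diagonal (fun i => (ω i : ℂ)))
    (hω : Antitone ω) :
    -- the pencil has exactly `n₊ + n₋ = rank B` finite eigenvalues, and they are real
    ((finiteEigenvalues A B).card = posInertia hB + negInertia hB ∧
      ∀ μ ∈ finiteEigenvalues A B, μ.im = 0) ∧
    -- finiteness of the infimum
    ((∀ c : ℝ, A ≠ (c : ℂ) • B) → (⊥ < traceInf A B D ↔ D.PosSemidef)) ∧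
    -- value of the infimum and its attainment
    (D.PosSemidef →
      traceInf A B D = ((∑ i : Fin k, ω i * posTypeEigenvalue A hB i : ℝ) : EReal) ∧
      (IsDiagonalizablePencil A B →
        (∃ X : Matrix (Fin n) (Fin k) ℂ, IsEigenvectorSolution A hB Q X) ∧
        ∀ X : Matrix (Fin n) (Fin k) ℂ, IsEigenvectorSolution A hB Q X →
          (((D * (Xᴴ * A * X)).trace.re : ℝ) : EReal) = traceInf A B D)) := by
  obtain ⟨hA, -, l₀, hAB⟩ := hpencil
  obtain ⟨m, T, T', W, W', S, hTW, hTW', hT'W, hT'W', hS, hAT, hBT⟩ :=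
    exists_congr_decomposition hB rfl rfl hAB
  obtain ⟨l, hmono, hpos, hneg, hdet, hval⟩ := exists_eigenvalues_of_posSemidef hS
  have hfin := finiteEigenvalues_of_decomposition hTW hTW' hT'W hT'W' hAT hBT hdet
  have htype : ∀ j : Fin k, posTypeEigenvalue A hB j = l (Sum.inl (Fin.castLE hk j)) := fun j =>
    posTypeEigenvalue_eq hB rfl hfin hmono hpos hneg (Fin.castLE hk j)
  have hinf : D.PosSemidef →
      traceInf A B D = ((∑ i : Fin k, ω i * posTypeEigenvalue A hB i : ℝ) : EReal) := by
    intro hDpsd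
    have hω0 := (posSemidef_iff_of_unitary_diagonal hQ hQD).mp hDpsd
    obtain ⟨hle, hlt⟩ := hval hk ω hω hω0
    simp only [htype]
    refine traceInf_eq hQ hQD (fun Y hY => ?_) fun δ hδ => ?_
    · obtain ⟨hYA, hYB⟩ := conjTranspose_mul_mul_eq_of_decomposition hAT hBT Y
      refine (hle _ (hYB.symm.trans hY)).trans (Finset.sum_le_sum fun j _ =>
        mul_le_mul_of_nonneg_left ?_ (hω0 j))
      rw [hYA, Matrix.add_apply, Complex.add_re]
      exact le_add_of_nonneg_right
        (Complex.le_def.mp (Matrix.posSemidef_conjTranspose_mul_self (T' * Y)).diag_nonneg).1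
    · obtain ⟨Z, hZJ, hZ⟩ := hlt δ hδ
      obtain ⟨hYA, hYB⟩ := conjTranspose_mul_mul_of_decomposition hTW hTW' hT'W hT'W' hAT hBT Z 0
      refine ⟨_, hYB.trans hZJ, ?_⟩
      rwa [hYA, Matrix.mul_zero, add_zero]
  refine ⟨⟨?_, ?_⟩, fun hne => ⟨fun h => ?_, fun h => ?_⟩, fun h => ⟨hinf h, fun hdiag =>
    ⟨exists_isEigenvectorSolution hA hB hAB hk hQ hdiag, fun X hX => ?_⟩⟩⟩
  · rw [hfin]
    simp
  · intro μ hμ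
    rw [hfin, Multiset.mem_map] at hμ
    obtain ⟨x, -, rfl⟩ := hμ
    exact Complex.ofReal_im _
  · rw [posSemidef_iff_of_unitary_diagonal hQ hQD]
    by_contra! hneg'
    obtain ⟨j₀, hj₀⟩ := hneg'
    obtain ⟨c, hc⟩ := exists_large_frame hTW hTW' hT'W hT'W' hS hAT hBT (hne l₀) hBneg hk j₀
    exact not_bot_lt_traceInf hQ hQD hj₀ c hc h
  · rw [hinf h]
    exact EReal.bot_lt_coe _
  · rw [hinf h, trace_eq_weighted_sum hQ hQD]
    simp only [conjTranspose_mul_mul_apply_of_isEigenvectorSolution hQ hX]
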